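/- Notation. Let $\mathrm{Sym}$ be the $\mathbb{Q}$-algebra of symmetric functions in commuting variables $\mathbf{x}=(x_1,x_2,\dots)$, let $e_k$, $h_\lambda$, $m_\lambda$ be the elementary, complete homogeneous and monomial symmetric functions, and let $\langle\cdot,\cdot\rangle$ be the Hall inner product on $\mathrm{Sym}$, the bilinear form with $\langle m_\lambda,h_\mu\rangle=\delta_{\lambda\mu}$. For $a\in\mathrm{Sym}$ the skewing operator $a^\perp$ is the linear map on $\mathrm{Sym}$ with $\langle a^\perp f,g\rangle=\langle f,ag\rangle$ for all $f,g\in\mathrm{Sym}$. Let $\mathrm{Par}$ be the set of all integer partitions. Let $\mathcal{U}=\mathbb{Q}\langle u_1,\dots,u_N\rangle$ be the free associative algebra, and for $k\ge 1$ let $\mathbf{e}_k(\mathbf{u})=\sum_{N\ge i_1>\dots>i_k\ge 1}u_{i_1}\cdots u_{i_k}$. Put $\mathbf{h}_0(\mathbf{u})=1$ and $\mathbf{h}_k(\mathbf{u})=\sum_{i=1}^{k}(-1)^{i-1}\mathbf{e}_i(\mathbf{u})\mathbf{h}_{k-i}(\mathbf{u})$ for $k\ge 1$. Let $$\Omega(\mathbf{x},\mathbf{u})=H(x_1,\mathbf{u})H(x_2,\mathbf{u})\cdots\in\mathcal{U}[[\mathbf{x}]],\qquad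 H(x,\mathbf{u})=\sum_{\ell\ge 0}x^\ell\,\mathbf{h}_\ell(\mathbf{u}),$$ where the variables $\mathbf{x}$ commute with $\mathbf{u}$. A two-sided ideal $I$ of $\mathcal{U}$ satisfies the commutation relation if $\mathbf{e}_k(\mathbf{u})\mathbf{e}_\ell(\mathbf{u})\equiv\mathbf{e}_\ell(\mathbf{u})\mathbf{e}_k(\mathbf{u})\pmod I$ for all $k,\ell\ge 1$; then let $\phi:\mathrm{Sym}\to\mathcal{U}/I$ be the unique $\mathbb{Q}$-algebra homomorphism with $\phi(e_k)=\mathbf{e}_k(\mathbf{u})$ mod $I$ for all $k\ge 1$. Let $\mathcal{U}^*$ be the free $\mathbb{Z}$-module on the words $w$ in the alphabet $\{1,\dots,N\}$, paired with $\mathcal{U}$ by $\langle u_w,v\rangle=\delta_{w,v}$, where $u_w=u_{w_1}\cdots u_{w_d}$ for a word $w=w_1\cdots w_d$; extend the pairing coefficientwise to $\mathcal{U}[[\mathbf{x}]]\times\mathcal{U}^*$, with values in $\mathbb{Q}[[\mathbf{x}]]$. Let $I^\perp=\{\gamma\in\mathcal{U}^*: \langle z,\gamma\rangle=0\text{ for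 all }z\in I\}$. For $\gamma=\sum_w\gamma_w w\in\mathcal{U}^*$ let $F_\gamma(\mathbf{x})=\sum_w\gamma_w F_{d(w),\mathrm{Des}(w)}(\mathbf{x})$, where $d(w)$ is the length of $w$, $\mathrm{Des}(w)=\{i: 1\le i<d(w),\ w_i>w_{i+1}\}$, and $F_{d,S}(\mathbf{x})$ is the fundamental quasisymmetric function, i.e. the sum of $x_{i_1}\cdots x_{i_d}$ over all $i_1\le\dots\le i_d$ with $i_j<i_{j+1}$ whenever $j\in S$. Theorem. Let $\{f_\lambda\}_{\lambda\in\mathrm{Par}}$ and $\{g_\lambda\}_{\lambda\in\mathrm{Par}}$ be bases of $\mathrm{Sym}$ that are dual to each other, $\langle f_\lambda,g_\mu\rangle=\delta_{\lambda\mu}$. Let $I$ be a two-sided ideal of $\mathcal{U}$ satisfying the commutation relation, and for each $\lambda$ let $\mathfrak{f}_\lambda(\mathbf{u})\in\mathcal{U}$ be any representative of $\phi(f_\lambda)$. Then: 1. For every $\mu\in\mathrm{Par}$, $$\mathfrak{f}_\mu(\mathbf{u})\,\Omega(\mathbf{x},\mathbf{u})\equiv\sum_{\lambda\in\mathrm{Par}}\mathfrak{f}_\lambda(\mathbf{u})\,f_\mu^\perp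 g_\lambda(\mathbf{x})\pmod{I[[\mathbf{x}]]},$$ where only finitely many terms of the sum on the right contribute to the coefficient of any given monomial in $\mathbf{x}$, and $I[[\mathbf{x}]]$ is the set of power series all of whose coefficients lie in $I$. 2. For every $\gamma\in I^\perp$, $F_\gamma(\mathbf{x})$ is a symmetric function, and for all $\mu,\lambda\in\mathrm{Par}$, $$f_\mu^\perp F_\gamma(\mathbf{x})=\langle\mathfrak{f}_\mu(\mathbf{u})\,\Omega(\mathbf{x},\mathbf{u}),\gamma\rangle,$$ and the coefficient of $g_\lambda$ in the expansion of $f_\mu^\perp F_\gamma$ in the basis $\{g_\lambda\}$ equals $\langle\mathfrak{f}_\mu(\mathbf{u})\,\mathfrak{f}_\lambda(\mathbf{u}),\gamma\rangle$. -/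

import Mathlib

noncomputable section

namespace NCSkew

open Finset

/-- Integer partitions of all sizes. -/
abbrev Par : Type := Σ n : ℕ, n.Partition

/-- A formal power series has bounded degree. -/
def BoundedDegree (f : MvPowerSeries ℕ ℚ) : Prop :=
  ∃ d : ℕ, ∀ α : ℕ →₀ ℕ, d < α.degree → MvPowerSeries.coeff α f = 0

/-- The `ℚ`-algebra `Sym` of symmetric functions in the variables `x_0, x_1, x_2, …`: formal power
series of bounded degree that are invariant under all permutations of the variables. -/
def SymFun : Subalgebra ℚ (MvPowerSeries ℕ ℚ) where
  carrier := {f | BoundedDegree f ∧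
    ∀ σ : Equiv.Perm ℕ, MvPowerSeries.renameEquiv ℚ σ f = f}
  mul_mem' := by
    rintro f g ⟨⟨d, hd⟩, hf⟩ ⟨⟨d', hd'⟩, hg⟩
    refine ⟨⟨d + d', fun α hα => ?_⟩, fun σ => by rw [map_mul, hf, hg]⟩
    classical
    rw [MvPowerSeries.coeff_mul]
    refine Finset.sum_eq_zero fun p hp => ?_
    have hp' : p.1 + p.2 = α := by simpa using hp
    have : p.1.degree + p.2.degree = α.degree := by rw [← hp', map_add]
    rcases lt_or_ge d p.1.degree with h | h
    · rw [hd _ h, zero_mul]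
    · rw [hd' _ (by omega), mul_zero]
  add_mem' := by
    rintro f g ⟨⟨d, hd⟩, hf⟩ ⟨⟨d', hd'⟩, hg⟩
    refine ⟨⟨d + d', fun α hα => ?_⟩, fun σ => by rw [map_add, hf, hg]⟩
    rw [map_add, hd _ (by omega), hd' _ (by omega), add_zero]
  algebraMap_mem' := by
    intro r
    refine ⟨⟨0, fun α hα => ?_⟩, fun σ => AlgEquiv.commutes _ r⟩
    classical
    rw [MvPowerSeries.algebraMap_apply, MvPowerSeries.coeff_C, if_neg]
    rintro rfl
    simp at hα

/-- Membership in `SymFun`, read on coefficients. -/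
theorem mem_symFun_iff (f : MvPowerSeries ℕ ℚ) :
    f ∈ SymFun ↔ BoundedDegree f ∧ ∀ (σ : Equiv.Perm ℕ) (α : ℕ →₀ ℕ),
      MvPowerSeries.coeff (α.embDomain σ.toEmbedding) f = MvPowerSeries.coeff α f := by
  refine and_congr_right fun _ => forall_congr' fun σ => ?_
  have key : ∀ α, MvPowerSeries.coeff (α.embDomain σ.toEmbedding)
      (MvPowerSeries.renameEquiv ℚ σ f) = MvPowerSeries.coeff α f :=
    fun α => MvPowerSeries.coeff_embDomain_rename σ.toEmbedding f α
  constructor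
  · intro h α
    rw [← key α, h]
  · intro h
    ext α
    obtain ⟨β, rfl⟩ : ∃ β : ℕ →₀ ℕ, β.embDomain σ.toEmbedding = α := by
      refine ⟨α.embDomain σ.symm.toEmbedding, ?_⟩
      ext i
      obtain ⟨j, rfl⟩ := σ.surjective i
      have := Finsupp.embDomain_apply_self σ.toEmbedding (α.embDomain σ.symm.toEmbedding) j
      have h2 := Finsupp.embDomain_apply_self σ.symm.toEmbedding α (σ j)
      simp only [Equiv.coe_toEmbedding, Equiv.symm_apply_apply] at this h2
      rw [this, h2]
    rw [key, h]

/-- The multiset of nonzero entries of an exponent vector. -/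
def shape (α : ℕ →₀ ℕ) : Multiset ℕ := α.support.val.map α

theorem shape_embDomain (σ : ℕ ↪ ℕ) (α : ℕ →₀ ℕ) : shape (α.embDomain σ) = shape α := by
  simp [shape, Finsupp.support_embDomain, Finset.map_val, Multiset.map_map]

theorem shape_sum (α : ℕ →₀ ℕ) : (shape α).sum = α.degree := rfl

theorem degree_embDomain (σ : ℕ ↪ ℕ) (α : ℕ →₀ ℕ) : (α.embDomain σ).degree = α.degree := by
  rw [← shape_sum, shape_embDomain, shape_sum]

/-- The monomial symmetric function `m_λ`. -/
def mono (lam : Par) : SymFun :=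
  ⟨fun α => if shape α = lam.2.parts then 1 else 0, (mem_symFun_iff _).2
    ⟨⟨lam.1, fun α hα => if_neg fun h => by
      have := shape_sum α
      rw [h, lam.2.parts_sum] at this
      omega⟩, fun σ α => by
      change ite _ _ _ = ite _ _ _
      rw [shape_embDomain]⟩⟩

/-- The elementary symmetric function `e_k`, the sum of all squarefree monomials of degree `k`. -/
def elem (k : ℕ) : SymFun :=
  ⟨fun α => if α.degree = k ∧ ∀ i ∈ α.support, α i = 1 then 1 else 0, (mem_symFun_iff _).2
    ⟨⟨k, fun α hα => if_neg fun h => by omega⟩, fun σ α => by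
      have : (∀ i ∈ (α.embDomain σ.toEmbedding).support, (α.embDomain σ.toEmbedding) i = 1) ↔
          ∀ i ∈ α.support, α i = 1 := by
        simp only [Finsupp.support_embDomain, Finset.forall_mem_map,
          Finsupp.embDomain_apply_self]
      change ite _ _ _ = ite _ _ _
      exact if_congr (by rw [degree_embDomain, this]) rfl rfl⟩⟩

/-- The complete homogeneous symmetric function `h_k`, the sum of all monomials of degree `k`. -/
def complete (k : ℕ) : SymFun :=
  ⟨fun α => if α.degree = k then 1 else 0, (mem_symFun_iff _).2
    ⟨⟨k, fun α hα => if_neg fun h => by omega⟩, fun σ α => by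
      change ite _ _ _ = ite _ _ _
      rw [degree_embDomain]⟩⟩

/-- `e_λ = e_{λ_1} e_{λ_2} ⋯`. -/
def elemPart (lam : Par) : SymFun := (lam.2.parts.map elem).prod

/-- `h_λ = h_{λ_1} h_{λ_2} ⋯`. -/
def completePart (lam : Par) : SymFun := (lam.2.parts.map complete).prod

/-! ### The monomial basis -/

theorem coeff_mono (lam : Par) (α : ℕ →₀ ℕ) :
    MvPowerSeries.coeff α (mono lam : MvPowerSeries ℕ ℚ) =
      if shape α = lam.2.parts then 1 else 0 := rfl

theorem par_ext {a b : Par} (h : a.2.parts = b.2.parts) : a = b := by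
  obtain ⟨n, a⟩ := a
  obtain ⟨m, b⟩ := b
  obtain rfl : n = m := by rw [← a.parts_sum, ← b.parts_sum]; exact congrArg _ h
  exact congrArg _ (Nat.Partition.ext h)

/-- The partition underlying an exponent vector. -/
def parOf (α : ℕ →₀ ℕ) : Par :=
  ⟨α.degree, ⟨shape α, fun {i} hi => by
    obtain ⟨j, hj, rfl⟩ := Multiset.mem_map.1 hi
    exact Nat.pos_of_ne_zero (Finsupp.mem_support_iff.1 hj), shape_sum α⟩⟩

theorem exists_perm {α β : ℕ →₀ ℕ} (h : shape α = shape β) :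
    ∃ σ : Equiv.Perm ℕ, α.embDomain σ.toEmbedding = β := by
  classical
  obtain ⟨n, hα, hβ⟩ : ∃ n, α.support ⊆ range n ∧ β.support ⊆ range n := by
    obtain ⟨n, hn⟩ := (α.support ∪ β.support).exists_nat_subset_range
    exact ⟨n, subset_union_left.trans hn, subset_union_right.trans hn⟩
  have fill : ∀ γ : ℕ →₀ ℕ, γ.support ⊆ range n → (Finset.univ : Finset (Fin n)).val.map
      (fun i : Fin n => γ i) = shape γ + Multiset.replicate (n - (shape γ).card) 0 := by
    intro γ hγ
    have h1 : (Finset.univ : Finset (Fin n)).val.map (fun i : Fin n => γ i) = (range n).val.map γ := by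
      have : (range n) = (Finset.univ : Finset (Fin n)).map Fin.valEmbedding := by
        ext i; simp
      rw [this, Finset.map_val, Multiset.map_map]; rfl
    have h2 : (range n).val = γ.support.val + (range n \ γ.support).val := by
      rw [← Finset.disjUnion_val _ _ disjoint_sdiff, Finset.disjUnion_eq_union,
        union_sdiff_of_subset hγ]
    rw [h1, h2, Multiset.map_add]
    congr 1
    rw [Multiset.eq_replicate]
    refine ⟨?_, fun b hb => ?_⟩
    · rw [Multiset.card_map, Finset.card_val, card_sdiff_of_subset hγ]
      simp [shape]
    · obtain ⟨i, hi, rfl⟩ := Multiset.mem_map.1 hb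
      simpa using (mem_sdiff.1 hi).2
  have h3 : (Finset.univ : Finset (Fin n)).val.map (fun i : Fin n => α i) =
      (Finset.univ : Finset (Fin n)).val.map (fun i : Fin n => β i) := by
    rw [fill α hα, fill β hβ, h]
  obtain ⟨τ, hτ⟩ : ∃ τ : Equiv.Perm (Fin n), ∀ i, β (τ i) = α i := by
    set a : Fin n → ℕ := fun i => α i
    set b : Fin n → ℕ := fun i => β i
    have h5 : (List.ofFn a).Perm (List.ofFn b) := by
      have h6 : ∀ c : Fin n → ℕ, (List.ofFn c : Multiset ℕ) = Finset.univ.val.map c :=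
        fun c => by simp [Fin.univ_val_map]
      exact Multiset.coe_eq_coe.1 (by rw [h6, h6, h3])
    have h7 : List.ofFn (a ∘ Tuple.sort a) = List.ofFn (b ∘ Tuple.sort b) :=
      ((((Tuple.sort a).ofFn_comp_perm a).trans h5).trans
        ((Tuple.sort b).ofFn_comp_perm b).symm).eq_of_pairwise' (r := (· ≤ ·))
        (Tuple.monotone_sort a).sortedLE_ofFn.pairwise
        (Tuple.monotone_sort b).sortedLE_ofFn.pairwise
    have h8 := List.ofFn_injective h7
    refine ⟨(Tuple.sort a).symm.trans (Tuple.sort b), fun i => ?_⟩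
    have := congrFun h8 ((Tuple.sort a).symm i)
    simpa [a, b] using this.symm
  refine ⟨τ.extendDomain (Fin.equivSubtype (n := n)), ?_⟩
  ext i
  obtain ⟨j, rfl⟩ := (τ.extendDomain (Fin.equivSubtype (n := n))).surjective i
  rw [← Equiv.coe_toEmbedding, Finsupp.embDomain_apply_self, Equiv.coe_toEmbedding]
  by_cases hj : j < n
  · have := Equiv.Perm.extendDomain_apply_image τ (Fin.equivSubtype (n := n)) ⟨j, hj⟩
    have h4 : ((Fin.equivSubtype ⟨j, hj⟩ : {i // i < n}) : ℕ) = j := rfl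
    rw [h4] at this
    rw [this]
    exact (hτ ⟨j, hj⟩).symm
  · have h9 : τ.extendDomain (Fin.equivSubtype (n := n)) j = j :=
      Equiv.Perm.extendDomain_apply_not_subtype _ _ hj
    rw [h9]
    have hz : ∀ γ : ℕ →₀ ℕ, γ.support ⊆ range n → γ j = 0 := fun γ hγ => by
      by_contra h0
      exact hj (mem_range.1 (hγ (Finsupp.mem_support_iff.2 h0)))
    rw [hz α hα, hz β hβ]

theorem coeff_eq_of_shape (f : SymFun) {α β : ℕ →₀ ℕ} (h : shape α = shape β) :
    MvPowerSeries.coeff α (f : MvPowerSeries ℕ ℚ) = MvPowerSeries.coeff β f.1 := by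
  obtain ⟨σ, rfl⟩ := exists_perm h
  exact (((mem_symFun_iff _).1 f.2).2 σ α).symm

/-- The exponent vector of a partition. -/
def expo (lam : Par) : ℕ →₀ ℕ := (lam.2.parts.toList).toFinsupp

theorem shape_expo (lam : Par) : shape (expo lam) = lam.2.parts := by
  classical
  have h : (lam.2.parts.toList : Multiset ℕ) = lam.2.parts := Multiset.coe_toList _
  have hpos : ∀ i ∈ lam.2.parts.toList, i ≠ 0 := fun i hi =>
    (lam.2.parts_pos (Multiset.mem_toList.1 hi)).ne'
  rw [← h, expo]
  generalize lam.2.parts.toList = l at hpos ⊢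
  have hs : (l.toFinsupp).support = range l.length := by
    ext i
    simp only [List.toFinsupp_support, mem_filter, mem_range, and_iff_left_iff_imp]
    intro hi
    rw [List.getD_eq_getElem _ _ hi]
    exact hpos _ (List.getElem_mem hi)
  rw [shape, hs, Finset.range_val, Multiset.range, Multiset.map_coe]
  congr 1
  apply List.ext_getElem
  · simp
  · intro i h1 h2
    simp [h2]

theorem parOf_expo (lam : Par) : parOf (expo lam) = lam := par_ext (shape_expo lam)

theorem finite_par (n : ℕ) : {lam : Par | lam.1 ≤ n}.Finite := by
  refine ((Finset.range (n + 1)).sigma fun k => (Finset.univ : Finset k.Partition)).finite_toSet.subset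
    fun lam h => ?_
  simpa [Nat.lt_succ_iff] using h

theorem coeff_expo_mono (lam mu : Par) :
    MvPowerSeries.coeff (expo lam) (mono mu : MvPowerSeries ℕ ℚ) = if lam = mu then 1 else 0 := by
  rw [coeff_mono, shape_expo]
  exact if_congr ⟨par_ext, fun h => by rw [h]⟩ rfl rfl

/-- The linear functional reading off the coefficient of a monomial. -/
def coeffFun (α : ℕ →₀ ℕ) : SymFun →ₗ[ℚ] ℚ :=
  (MvPowerSeries.coeff α).comp SymFun.val.toLinearMap

theorem coeffFun_apply (α : ℕ →₀ ℕ) (f : SymFun) :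
    coeffFun α f = MvPowerSeries.coeff α (f : MvPowerSeries ℕ ℚ) := rfl

theorem symFun_ext {f g : SymFun} (h : ∀ lam, coeffFun (expo lam) f = coeffFun (expo lam) g) :
    f = g := by
  apply Subtype.ext
  ext α
  have hs : shape α = shape (expo (parOf α)) := (shape_expo (parOf α)).symm
  rw [coeff_eq_of_shape f hs, coeff_eq_of_shape g hs]
  exact h _

theorem linearIndependent_mono : LinearIndependent ℚ mono := by
  rw [linearIndependent_iff]
  intro c hc
  ext lam
  have := congrArg (coeffFun (expo lam)) hc
  rw [Finsupp.linearCombination_apply, Finsupp.sum, map_sum, map_zero] at this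
  simpa [coeffFun_apply, coeff_expo_mono, Finset.sum_ite_eq] using this

theorem eq_sum_mono (f : SymFun) (n : ℕ)
    (hn : ∀ α : ℕ →₀ ℕ, n < α.degree → coeffFun α f = 0) :
    f = ∑ lam ∈ (finite_par n).toFinset, coeffFun (expo lam) f • mono lam := by
  refine symFun_ext fun mu => ?_
  rw [map_sum]
  simp only [map_smul, coeffFun_apply _ (mono _), coeff_expo_mono, smul_eq_mul, mul_ite, mul_one,
    mul_zero, Finset.sum_ite_eq]
  split_ifs with h
  · rfl
  · refine hn _ ?_
    rw [← shape_sum, shape_expo, mu.2.parts_sum]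
    simpa using h

theorem span_mono : ⊤ ≤ Submodule.span ℚ (Set.range mono) := by
  intro f _
  obtain ⟨n, hn⟩ := f.2.1
  rw [eq_sum_mono f n hn]
  exact Submodule.sum_mem _ fun lam _ =>
    Submodule.smul_mem _ _ (Submodule.subset_span ⟨lam, rfl⟩)

/-- The monomial symmetric functions form a basis of `Sym`. -/
def monoBasis : Module.Basis Par ℚ SymFun := .mk linearIndependent_mono span_mono

@[simp] theorem monoBasis_apply (lam : Par) : monoBasis lam = mono lam := by simp [monoBasis]

/-! ### The elementary basis -/

/-- Partitions as multiplicity functions on the positive integers. -/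
def parEquiv : (ℕ+ →₀ ℕ) ≃ Par :=
  Multiset.toFinsupp.symm.toEquiv.trans <| Equiv.ofBijective
    (fun s : Multiset ℕ+ => (⟨(s.map (fun i : ℕ+ => (i : ℕ))).sum,
      ⟨s.map (fun i : ℕ+ => (i : ℕ)), fun {i} hi => by
        obtain ⟨j, _, rfl⟩ := Multiset.mem_map.1 hi
        exact j.pos, rfl⟩⟩ : Par))
    ⟨fun s t h => Multiset.map_injective PNat.coe_injective
        (congrArg (fun lam : Par => lam.2.parts) h),
      fun lam => by
        obtain ⟨s, hs⟩ := Multiset.canLift (fun i : ℕ+ => (i : ℕ)) (fun i => 0 < i) |>.prf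
          lam.2.parts (fun i hi => lam.2.parts_pos hi)
        exact ⟨s, par_ext hs⟩⟩

theorem parEquiv_parts (s : ℕ+ →₀ ℕ) :
    (parEquiv s).2.parts = s.toMultiset.map (fun i : ℕ+ => (i : ℕ)) := rfl

theorem parEquiv_add (s t : ℕ+ →₀ ℕ) :
    (parEquiv (s + t)).2.parts = (parEquiv s).2.parts + (parEquiv t).2.parts := by
  simp [parEquiv_parts]

theorem prod_parts (u : ℕ → SymFun) (s : ℕ+ →₀ ℕ) :
    (((parEquiv s).2.parts).map u).prod =
      MvPolynomial.aeval (fun k : ℕ+ => u k) (MvPolynomial.monomial s (1 : ℚ)) := by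
  rw [parEquiv_parts, Multiset.map_map, MvPolynomial.aeval_monomial, map_one, one_mul,
    Finsupp.toMultiset_map, Finsupp.prod_toMultiset, Finsupp.prod_mapDomain_index
      (fun _ => pow_zero _) (fun _ _ _ => pow_add _ _ _)]
  rfl

theorem coeff_elem (k : ℕ) (α : ℕ →₀ ℕ) :
    MvPowerSeries.coeff α (elem k : MvPowerSeries ℕ ℚ) =
      if α.degree = k ∧ ∀ i ∈ α.support, α i = 1 then 1 else 0 := rfl

theorem coeff_complete (k : ℕ) (α : ℕ →₀ ℕ) :
    MvPowerSeries.coeff α (complete k : MvPowerSeries ℕ ℚ) =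
      if α.degree = k then 1 else 0 := rfl

/-- Setting all but the first `n` variables to zero. -/
def restrict (n : ℕ) : SymFun →ₐ[ℚ] MvPowerSeries (Fin n) ℚ :=
  (MvPowerSeries.killCompl Fin.valEmbedding).comp SymFun.val

theorem restrict_elem (n k : ℕ) :
    restrict n (elem k) = (MvPolynomial.esymm (Fin n) ℚ k : MvPowerSeries (Fin n) ℚ) := by
  classical
  ext β
  have h1 : MvPowerSeries.coeff β (restrict n (elem k)) =
      if β.degree = k ∧ ∀ i ∈ β.support, β i = 1 then 1 else 0 := by
    have h2 : (β.embDomain Fin.valEmbedding).degree = β.degree := by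
      rw [Finsupp.embDomain_eq_mapDomain, Finsupp.degree_mapDomain]
    rw [restrict, AlgHom.comp_apply, MvPowerSeries.coeff_killCompl]
    refine (coeff_elem k _).trans (if_congr ?_ rfl rfl)
    rw [h2]
    simp only [Finsupp.support_embDomain, Finset.forall_mem_map, Finsupp.embDomain_apply_self]
  rw [h1, MvPolynomial.coeff_coe, MvPolynomial.esymm_eq_sum_monomial, MvPolynomial.coeff_sum]
  simp only [MvPolynomial.coeff_monomial]
  have h3 : ∀ t : Finset (Fin n), ∀ i, (∑ j ∈ t, Finsupp.single j 1 : Fin n →₀ ℕ) i =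
      if i ∈ t then 1 else 0 := fun t i => by
    simp [Finsupp.finsetSum_apply, Finsupp.single_apply]
  have h4 : ∀ t : Finset (Fin n), (∑ j ∈ t, Finsupp.single j 1 : Fin n →₀ ℕ) = β ↔
      (t = β.support ∧ ∀ i ∈ β.support, β i = 1) := by
    intro t
    constructor
    · rintro rfl
      constructor
      · ext i; simp [h3]
      · intro i hi
        by_contra hne
        have := h3 t i
        split_ifs at this <;> simp_all
    · rintro ⟨rfl, h⟩
      ext i
      rw [h3]
      split_ifs with hi
      · exact (h i hi).symm
      · exact (Finsupp.notMem_support_iff.1 hi).symm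
  simp only [h4]
  by_cases hβ : ∀ i ∈ β.support, β i = 1
  · have h5 : β.degree = β.support.card := by
      rw [Finsupp.degree_apply, Finset.card_eq_sum_ones]
      exact Finset.sum_congr rfl hβ
    have hP := eq_true hβ
    simp only [h5, hP, and_true, Finset.sum_ite_eq', mem_powersetCard, subset_univ, true_and]
  · have hP := eq_false hβ
    simp only [hP, and_false, if_false, Finset.sum_const_zero]

/-- The algebra map from the polynomial ring in `e_1, e_2, …` to `Sym`. -/
def elemHom : MvPolynomial ℕ+ ℚ →ₐ[ℚ] SymFun := MvPolynomial.aeval fun k : ℕ+ => elem k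

theorem elemHom_injective : Function.Injective elemHom := by
  rw [injective_iff_map_eq_zero]
  intro p hp
  obtain ⟨n, hn⟩ : ∃ n : ℕ, ∀ k ∈ p.vars, (k : ℕ) ≤ n :=
    ⟨p.vars.sup (fun k => (k : ℕ)), fun k hk => Finset.le_sup (f := fun k : ℕ+ => (k : ℕ)) hk⟩
  let ι : Fin n → ℕ+ := fun i => Nat.succPNat i
  have hι : Function.Injective ι := fun i j h => Fin.ext (Nat.succPNat_injective h)
  obtain ⟨q, rfl⟩ := MvPolynomial.exists_rename_eq_of_vars_subset_range p ι hι (fun k hk =>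
    ⟨⟨k.natPred, by have := hn k hk; have := PNat.natPred_add_one k; omega⟩,
      PNat.succPNat_natPred k⟩)
  have h1 : (restrict n).comp (elemHom.comp (MvPolynomial.rename ι)) =
      (MvPolynomial.coeToMvPowerSeries.algHom ℚ).comp
        ((MvPolynomial.symmetricSubalgebra (Fin n) ℚ).val.comp
          (MvPolynomial.esymmAlgHom (Fin n) ℚ n)) := by
    ext1 i
    simp only [AlgHom.comp_apply, MvPolynomial.rename_X]
    rw [elemHom, MvPolynomial.aeval_X]
    change restrict n (elem (i + 1)) = _
    rw [restrict_elem, Subalgebra.val_apply, MvPolynomial.esymmAlgHom_apply,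
      MvPolynomial.aeval_X]
    simp [MvPolynomial.coeToMvPowerSeries.algHom_apply]
  have h2 := DFunLike.congr_fun h1 q
  simp only [AlgHom.comp_apply] at h2
  rw [hp, map_zero, MvPolynomial.coeToMvPowerSeries.algHom_apply] at h2
  have h3 : MvPolynomial.esymmAlgHom (Fin n) ℚ n q = 0 := by
    apply Subtype.ext
    apply MvPolynomial.coe_injective
    simpa using h2.symm
  rw [(injective_iff_map_eq_zero _).1 (MvPolynomial.esymmAlgHom_fin_injective ℚ le_rfl) q h3,
    map_zero]

theorem linearIndependent_elemPart : LinearIndependent ℚ elemPart := by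
  have h : elemPart ∘ parEquiv = elemHom.toLinearMap ∘ MvPolynomial.basisMonomials ℕ+ ℚ := by
    ext1 s
    simp only [Function.comp_apply, MvPolynomial.coe_basisMonomials]
    exact prod_parts elem s
  rw [← linearIndependent_equiv parEquiv, h]
  exact (MvPolynomial.basisMonomials ℕ+ ℚ).linearIndependent.map' _
    (LinearMap.ker_eq_bot.2 elemHom_injective)

/-- A symmetric function that is homogeneous of degree `n`. -/
def IsHomog (n : ℕ) (f : SymFun) : Prop := ∀ α : ℕ →₀ ℕ, coeffFun α f ≠ 0 → α.degree = n

theorem IsHomog.mul {m n : ℕ} {f g : SymFun} (hf : IsHomog m f) (hg : IsHomog n g) :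
    IsHomog (m + n) (f * g) := by
  classical
  intro α hα
  rw [coeffFun_apply, Subalgebra.coe_mul, MvPowerSeries.coeff_mul] at hα
  obtain ⟨p, hp, hne⟩ := Finset.exists_ne_zero_of_sum_ne_zero hα
  rw [← hf p.1 (left_ne_zero_of_mul hne), ← hg p.2 (right_ne_zero_of_mul hne), ← map_add,
    Finset.HasAntidiagonal.mem_antidiagonal.1 hp]

theorem isHomog_prod {u : ℕ → SymFun} (hu : ∀ k, IsHomog k (u k)) (s : Multiset ℕ) :
    IsHomog s.sum (s.map u).prod := by
  classical
  induction s using Multiset.induction_on with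
  | empty =>
    intro α hα
    rw [Multiset.map_zero, Multiset.prod_zero, coeffFun_apply, Subalgebra.coe_one,
      MvPowerSeries.coeff_one] at hα
    by_contra h
    refine hα (if_neg ?_)
    rintro rfl
    simp at h
  | cons a s ih =>
    rw [Multiset.map_cons, Multiset.prod_cons, Multiset.sum_cons]
    exact (hu a).mul ih

theorem isHomog_elem (k : ℕ) : IsHomog k (elem k) := fun α hα => by
  by_contra h
  exact hα ((coeff_elem k α).trans (if_neg fun h' => h h'.1))

theorem IsHomog.mem_span {n : ℕ} {f : SymFun} (hf : IsHomog n f) :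
    f ∈ Submodule.span ℚ (Set.range fun lam : n.Partition => mono ⟨n, lam⟩) := by
  rw [eq_sum_mono f n fun α hα => by by_contra h; exact hα.ne' (hf α h)]
  refine Submodule.sum_mem _ fun lam _ => ?_
  by_cases h : coeffFun (expo lam) f = 0
  · rw [h, zero_smul]; exact Submodule.zero_mem _
  · have := hf _ h
    rw [← shape_sum, shape_expo, lam.2.parts_sum] at this
    obtain ⟨m, lam⟩ := lam
    obtain rfl : m = n := this
    exact Submodule.smul_mem _ _ (Submodule.subset_span ⟨lam, rfl⟩)

theorem span_elemPart : ⊤ ≤ Submodule.span ℚ (Set.range elemPart) := by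
  rw [← top_le_iff.1 span_mono, Submodule.span_le]
  rintro _ ⟨⟨n, lam⟩, rfl⟩
  let V := Submodule.span ℚ (Set.range fun lam : n.Partition => mono ⟨n, lam⟩)
  have hm : LinearIndependent ℚ fun lam : n.Partition => mono ⟨n, lam⟩ :=
    linearIndependent_mono.comp _ sigma_mk_injective
  have he : LinearIndependent ℚ fun lam : n.Partition => elemPart ⟨n, lam⟩ :=
    linearIndependent_elemPart.comp _ sigma_mk_injective
  have hV : Module.finrank ℚ V = Fintype.card n.Partition := finrank_span_eq_card hm
  have : FiniteDimensional ℚ V := FiniteDimensional.span_of_finite ℚ (Set.finite_range _)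
  have hsub : Submodule.span ℚ (Set.range fun lam : n.Partition => elemPart ⟨n, lam⟩) ≤ V := by
    rw [Submodule.span_le]
    rintro _ ⟨mu, rfl⟩
    have := isHomog_prod isHomog_elem mu.parts
    rw [mu.parts_sum] at this
    exact this.mem_span
  have heq := Submodule.eq_of_le_of_finrank_eq hsub (by rw [hV, finrank_span_eq_card he])
  have hmem : mono ⟨n, lam⟩ ∈ V := Submodule.subset_span ⟨lam, rfl⟩
  rw [← heq] at hmem
  refine Submodule.span_mono ?_ hmem
  rintro _ ⟨mu, rfl⟩
  exact ⟨_, rfl⟩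

theorem elemHom_bijective : Function.Bijective elemHom := by
  refine ⟨elemHom_injective, fun f => ?_⟩
  have : f ∈ LinearMap.range elemHom.toLinearMap := by
    refine (Submodule.span_le.2 ?_) (span_elemPart (Submodule.mem_top (x := f)))
    rintro _ ⟨lam, rfl⟩
    obtain ⟨s, rfl⟩ := parEquiv.surjective lam
    exact ⟨_, (prod_parts elem s).symm⟩
  exact this

/-- `Sym` is the polynomial ring in `e_1, e_2, …`. -/
def elemEquiv : MvPolynomial ℕ+ ℚ ≃ₐ[ℚ] SymFun := AlgEquiv.ofBijective elemHom elemHom_bijective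

theorem elemEquiv_symm_elem (k : ℕ+) : elemEquiv.symm (elem k) = MvPolynomial.X k := by
  rw [AlgEquiv.symm_apply_eq]
  exact (MvPolynomial.aeval_X (R := ℚ) (fun k : ℕ+ => elem k) k).symm

/-- The monomials `e_λ` form a basis of `Sym`. -/
def elemBasis : Module.Basis Par ℚ SymFun := .mk linearIndependent_elemPart span_elemPart

@[simp] theorem elemBasis_apply (lam : Par) : elemBasis lam = elemPart lam := by
  simp [elemBasis]

/-! ### The complete homogeneous basis -/

theorem elem_zero : elem 0 = 1 := by
  apply Subtype.ext
  ext α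
  classical
  rw [coeff_elem, Subalgebra.coe_one, MvPowerSeries.coeff_one]
  refine if_congr ⟨fun h => (Finsupp.degree_eq_zero_iff α).1 h.1, ?_⟩ rfl rfl
  rintro rfl
  simp

theorem complete_zero : complete 0 = 1 := by
  apply Subtype.ext
  ext α
  classical
  rw [coeff_complete, Subalgebra.coe_one, MvPowerSeries.coeff_one]
  exact if_congr (Finsupp.degree_eq_zero_iff α) rfl rfl

theorem elem_complete (n : ℕ) (hn : n ≠ 0) :
    ∑ p ∈ antidiagonal n, (-1) ^ p.1 * (elem p.1 * complete p.2) = 0 := by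
  classical
  apply Subtype.ext
  ext α
  rw [AddSubmonoidClass.coe_finsetSum, map_sum, ZeroMemClass.coe_zero, map_zero]
  have h1 : ∀ p : ℕ × ℕ, MvPowerSeries.coeff α
      (((-1) ^ p.1 * (elem p.1 * complete p.2) : SymFun) : MvPowerSeries ℕ ℚ) =
      ∑ q ∈ antidiagonal α, (-1) ^ p.1 * ((if q.1.degree = p.1 ∧ ∀ i ∈ q.1.support, q.1 i = 1
        then 1 else 0) * if q.2.degree = p.2 then 1 else 0) := by
    intro p
    have h2 : (((-1) ^ p.1 * (elem p.1 * complete p.2) : SymFun) : MvPowerSeries ℕ ℚ) =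
        ((-1 : ℚ) ^ p.1) • ((elem p.1 : MvPowerSeries ℕ ℚ) * complete p.2) := by
      rw [Subalgebra.coe_mul, Subalgebra.coe_mul, Subalgebra.coe_pow, Subalgebra.coe_neg,
        Subalgebra.coe_one]
      rcases neg_one_pow_eq_or (MvPowerSeries ℕ ℚ) p.1 with h | h <;>
      rcases Nat.even_or_odd p.1 with h' | h' <;> simp [h'.neg_one_pow]
    rw [h2, MvPowerSeries.coeff_smul, MvPowerSeries.coeff_mul, Finset.mul_sum]
    rfl
  simp only [h1]
  rw [Finset.sum_comm]
  by_cases hα : α.degree = n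
  swap
  · refine Finset.sum_eq_zero fun q hq => Finset.sum_eq_zero fun p hp => ?_
    have hq' := HasAntidiagonal.mem_antidiagonal.1 hq
    have hp' := HasAntidiagonal.mem_antidiagonal.1 hp
    have hd : q.1.degree + q.2.degree = α.degree := by rw [← map_add, hq']
    by_cases h3 : q.2.degree = p.2
    · rw [if_neg, zero_mul, mul_zero]
      rintro ⟨h4, -⟩
      omega
    · rw [if_neg h3, mul_zero, mul_zero]
  have h5 : ∀ q ∈ antidiagonal α, ∑ p ∈ antidiagonal n, (-1 : ℚ) ^ p.1 *
      ((if q.1.degree = p.1 ∧ ∀ i ∈ q.1.support, q.1 i = 1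
        then 1 else 0) * if q.2.degree = p.2 then 1 else 0) =
      if ∀ i ∈ q.1.support, q.1 i = 1 then (-1) ^ q.1.support.card else 0 := by
    intro q hq
    have hq' := HasAntidiagonal.mem_antidiagonal.1 hq
    have hd : q.1.degree + q.2.degree = α.degree := by rw [← map_add, hq']
    rw [Finset.sum_eq_single (q.1.degree, q.2.degree)]
    · simp only [true_and, if_true, mul_one]
      split_ifs with h6
      · rw [mul_one]
        congr 1
        rw [Finsupp.degree_apply, Finset.card_eq_sum_ones]
        exact Finset.sum_congr rfl h6
      · rw [mul_zero]
    · intro p hp hne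
      have hp' := HasAntidiagonal.mem_antidiagonal.1 hp
      by_cases h3 : q.2.degree = p.2
      · rw [if_neg, zero_mul, mul_zero]
        rintro ⟨h4, -⟩
        exact hne (Prod.ext h4.symm h3.symm)
      · rw [if_neg h3, mul_zero, mul_zero]
    · intro h
      exact absurd (HasAntidiagonal.mem_antidiagonal.2 (hd.trans hα)) h
  rw [Finset.sum_congr rfl h5, ← Finset.sum_filter]
  have hne : α.support.Nonempty := by
    rw [Finsupp.support_nonempty_iff]
    rintro rfl
    exact hn (by simpa using hα.symm)
  have h7 := Finset.sum_powerset_neg_one_pow_card_of_nonempty hne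
  have h8 : (∑ m ∈ α.support.powerset, (-1 : ℚ) ^ m.card) = 0 := by exact_mod_cast h7
  rw [← h8]
  have hone : ∀ (t : Finset ℕ) i, (Finsupp.indicator t fun _ _ => 1 : ℕ →₀ ℕ) i =
      if i ∈ t then 1 else 0 := fun t i => by
    rw [Finsupp.indicator_apply]; split_ifs <;> rfl
  have hsupp : ∀ t : Finset ℕ, (Finsupp.indicator t fun _ _ => 1 : ℕ →₀ ℕ).support = t := by
    intro t; ext i; rw [Finsupp.mem_support_iff, hone]; split_ifs with h <;> simp [h]
  refine Finset.sum_bij' (fun q _ => q.1.support)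
    (fun t _ => (Finsupp.indicator t fun _ _ => 1, α - Finsupp.indicator t fun _ _ => 1))
    ?_ ?_ ?_ ?_ ?_
  · intro q hq
    have hq' := HasAntidiagonal.mem_antidiagonal.1 (Finset.mem_filter.1 hq).1
    rw [Finset.mem_powerset, ← hq']
    intro i hi
    rw [Finsupp.mem_support_iff] at hi ⊢
    simp only [Finsupp.add_apply]
    omega
  · intro t ht
    rw [Finset.mem_filter, HasAntidiagonal.mem_antidiagonal]
    refine ⟨add_tsub_cancel_of_le fun i => ?_, fun i hi => ?_⟩
    · rw [hone]
      split_ifs with h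
      · exact Nat.one_le_iff_ne_zero.2 (Finsupp.mem_support_iff.1 (Finset.mem_powerset.1 ht h))
      · exact Nat.zero_le _
    · rw [hsupp] at hi
      rw [hone, if_pos hi]
  · intro q hq
    obtain ⟨hq1, hq2⟩ := Finset.mem_filter.1 hq
    have hq' := HasAntidiagonal.mem_antidiagonal.1 hq1
    have h9 : (Finsupp.indicator q.1.support fun _ _ => 1 : ℕ →₀ ℕ) = q.1 := by
      ext i
      rw [hone]
      split_ifs with h
      · exact (hq2 i h).symm
      · exact (Finsupp.notMem_support_iff.1 h).symm
    refine Prod.ext h9 ?_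
    simp only [h9, ← hq', add_tsub_cancel_left]
  · intro t ht
    exact hsupp t
  · intro q hq
    rfl

/-- The algebra endomorphism of `Sym` that maps `e_k` to `h_k`. -/
def omegaHom : SymFun →ₐ[ℚ] SymFun :=
  (MvPolynomial.aeval fun k : ℕ+ => complete k).comp elemEquiv.symm.toAlgHom

theorem omegaHom_elem (k : ℕ) : omegaHom (elem k) = complete k := by
  rcases Nat.eq_zero_or_pos k with rfl | hk
  · rw [elem_zero, map_one, complete_zero]
  · obtain ⟨k, rfl⟩ : ∃ j : ℕ+, (j : ℕ) = k := ⟨⟨k, hk⟩, rfl⟩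
    change MvPolynomial.aeval (fun k : ℕ+ => complete k) (elemEquiv.symm (elem k)) = _
    rw [elemEquiv_symm_elem, MvPolynomial.aeval_X]

theorem neg_one_pow_aux {R : Type*} [CommRing R] (i j : ℕ) (a b : R) :
    (-1) ^ i * (a * b) = (-1) ^ (i + j) * ((-1) ^ j * (b * a)) := by
  have : ((-1 : R) ^ j) * (-1) ^ j = 1 := by rw [← mul_pow]; simp
  linear_combination (-(-1) ^ i * a * b) * this

theorem omegaHom_complete (k : ℕ) : omegaHom (complete k) = elem k := by
  induction k using Nat.strong_induction_on with
  | _ k ih =>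
    rcases Nat.eq_zero_or_pos k with rfl | hk
    · rw [complete_zero, map_one, elem_zero]
    have h1 := congrArg omegaHom (elem_complete k hk.ne')
    rw [map_zero, map_sum] at h1
    simp only [map_mul, map_pow, map_neg, map_one, omegaHom_elem] at h1
    have h2 := elem_complete k hk.ne'
    rw [← Finset.Nat.sum_antidiagonal_swap] at h2
    have h3 : ∑ p ∈ antidiagonal k, (-1 : SymFun) ^ p.1 * (complete p.1 * elem p.2) = 0 := by
      have h4 : ∀ p ∈ antidiagonal k, (-1 : SymFun) ^ p.1 * (complete p.1 * elem p.2) =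
          (-1) ^ k * ((-1) ^ p.2 * (elem p.2 * complete p.1)) := by
        intro p hp
        rw [← HasAntidiagonal.mem_antidiagonal.1 hp]
        exact neg_one_pow_aux _ _ _ _
      rw [Finset.sum_congr rfl h4, ← Finset.mul_sum]
      exact mul_eq_zero_of_right _ h2
    have h5 : ∑ p ∈ antidiagonal k, (-1 : SymFun) ^ p.1 *
        (complete p.1 * (omegaHom (complete p.2) - elem p.2)) = 0 := by
      simp only [mul_sub, Finset.sum_sub_distrib, h1, h3, sub_zero]
    rw [Finset.sum_eq_single (0, k)] at h5
    · simpa [complete_zero, sub_eq_zero] using h5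
    · intro p hp hne
      have hp' := HasAntidiagonal.mem_antidiagonal.1 hp
      have : p.2 ≠ k := fun h => hne (Prod.ext (by simp; omega) h)
      rw [ih p.2 (by omega), sub_self, mul_zero, mul_zero]
    · intro h
      exact absurd (HasAntidiagonal.mem_antidiagonal.2 (zero_add k)) h

theorem symFun_algHom_ext {A : Type*} [Semiring A] [Algebra ℚ A] {F G : SymFun →ₐ[ℚ] A}
    (h : ∀ k : ℕ, 1 ≤ k → F (elem k) = G (elem k)) : F = G := by
  have h1 : F.comp elemEquiv.toAlgHom = G.comp elemEquiv.toAlgHom := by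
    ext k
    have : elemEquiv (MvPolynomial.X k) = elem k := by
      rw [← elemEquiv_symm_elem, AlgEquiv.apply_symm_apply]
    simpa [this] using h k k.pos
  ext1 f
  have h2 := DFunLike.congr_fun h1 (elemEquiv.symm f)
  simpa using h2

theorem omegaHom_omegaHom (f : SymFun) : omegaHom (omegaHom f) = f := by
  have : omegaHom.comp omegaHom = AlgHom.id ℚ SymFun :=
    symFun_algHom_ext fun k _ => by
      rw [AlgHom.comp_apply, omegaHom_elem, omegaHom_complete, AlgHom.id_apply]
  exact DFunLike.congr_fun this f

/-- The complete homogeneous symmetric functions `h_λ` form a basis of `Sym`. -/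
def completeBasis : Module.Basis Par ℚ SymFun :=
  elemBasis.map (LinearEquiv.ofInvolutive omegaHom.toLinearMap omegaHom_omegaHom)

@[simp] theorem completeBasis_apply (lam : Par) : completeBasis lam = completePart lam := by
  rw [completeBasis, Module.Basis.map_apply, elemBasis_apply]
  change omegaHom (elemPart lam) = _
  rw [elemPart, completePart, map_multiset_prod, Multiset.map_map]
  congr 1
  exact Multiset.map_congr rfl fun k _ => omegaHom_elem k

/-! ### The Hall inner product and skewing operators -/

/-- The Hall inner product: the bilinear form on `Sym` with `⟨m_λ, h_μ⟩ = δ_{λμ}`. -/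
def hall : SymFun →ₗ[ℚ] SymFun →ₗ[ℚ] ℚ :=
  monoBasis.constr ℚ fun lam => completeBasis.coord lam

theorem hall_mono_complete (lam mu : Par) :
    hall (mono lam) (completePart mu) = if lam = mu then 1 else 0 := by
  rw [← monoBasis_apply, ← completeBasis_apply, hall, Module.Basis.constr_basis,
    Module.Basis.coord_apply, Module.Basis.repr_self, Finsupp.single_apply]
  exact if_congr eq_comm rfl rfl

theorem hall_left_injective {s t : SymFun} (h : ∀ g, hall s g = hall t g) : s = t := by
  apply monoBasis.repr.injective
  have key : ∀ (f : SymFun) (lam : Par), hall f (completePart lam) = monoBasis.repr f lam := by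
    intro f lam
    have : hall.flip (completePart lam) = monoBasis.coord lam := monoBasis.ext fun mu => by
      rw [LinearMap.flip_apply, monoBasis_apply, hall_mono_complete, ← monoBasis_apply,
        Module.Basis.coord_apply, Module.Basis.repr_self, Finsupp.single_apply]
    exact DFunLike.congr_fun this f
  ext lam
  rw [← key, ← key, h]

/-- Multiplication by `a` has an adjoint with respect to the Hall inner product. -/
theorem existsUnique_skew (a f : SymFun) : ∃! s : SymFun, ∀ g, hall s g = hall f (a * g) := by
  refine existsUnique_of_exists_of_unique ?_ fun s t hs ht =>
    hall_left_injective fun g => (hs g).trans (ht g).symm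
  have hf : f ∈ Submodule.span ℚ (Set.range monoBasis) := by
    rw [monoBasis.span_eq]; trivial
  induction hf using Submodule.span_induction with
  | zero => exact ⟨0, fun g => by simp⟩
  | add x y _ _ hx hy =>
    obtain ⟨s, hs⟩ := hx
    obtain ⟨t, ht⟩ := hy
    exact ⟨s + t, fun g => by simp [hs, ht]⟩
  | smul c x _ hx =>
    obtain ⟨s, hs⟩ := hx
    exact ⟨c • s, fun g => by simp [hs]⟩
  | mem x hx =>
    obtain ⟨lam, rfl⟩ := hx
    obtain ⟨u, rfl⟩ := parEquiv.surjective lam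
    have ha : a ∈ Submodule.span ℚ (Set.range completeBasis) := by
      rw [completeBasis.span_eq]; trivial
    induction ha using Submodule.span_induction with
    | zero => exact ⟨0, fun g => by simp⟩
    | add x y _ _ hx hy =>
      obtain ⟨s, hs⟩ := hx
      obtain ⟨t, ht⟩ := hy
      exact ⟨s + t, fun g => by simp [hs, ht, add_mul]⟩
    | smul c x _ hx =>
      obtain ⟨s, hs⟩ := hx
      exact ⟨c • s, fun g => by simp [hs]⟩
    | mem x hx =>
      obtain ⟨mu, rfl⟩ := hx
      obtain ⟨v, rfl⟩ := parEquiv.surjective mu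
      classical
      refine ⟨if v ≤ u then mono (parEquiv (u - v)) else 0, fun g => ?_⟩
      suffices h : hall (if v ≤ u then mono (parEquiv (u - v)) else 0) =
          (hall (monoBasis (parEquiv u))).comp
            (LinearMap.mulLeft ℚ (completeBasis (parEquiv v))) from DFunLike.congr_fun h g
      refine completeBasis.ext fun nu => ?_
      obtain ⟨w, rfl⟩ := parEquiv.surjective nu
      have hmul : completePart (parEquiv v) * completePart (parEquiv w) =
          completePart (parEquiv (v + w)) := by
        simp only [completePart, parEquiv_add, Multiset.map_add, Multiset.prod_add]
      rw [LinearMap.comp_apply, LinearMap.mulLeft_apply, completeBasis_apply,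
        completeBasis_apply, monoBasis_apply, hmul, hall_mono_complete]
      simp only [parEquiv.injective.eq_iff]
      split_ifs with h1 h2 h2
      · rw [hall_mono_complete, if_pos (by rw [h2, add_tsub_cancel_left])]
      · rw [hall_mono_complete, if_neg]
        rw [parEquiv.injective.eq_iff]
        rintro rfl
        exact h2 (add_tsub_cancel_of_le h1).symm
      · exact absurd (h2 ▸ le_self_add) h1
      · simp

/-- The skewing operator `a^⊥`, the adjoint of multiplication by `a` with respect to the Hall
inner product. -/
def skew (a : SymFun) : SymFun →ₗ[ℚ] SymFun where
  toFun f := (existsUnique_skew a f).choose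
  map_add' x y := (existsUnique_skew a (x + y)).unique (existsUnique_skew a (x + y)).choose_spec.1
    fun g => by
      simp only [map_add, LinearMap.add_apply, (existsUnique_skew a _).choose_spec.1 g]
  map_smul' c x := (existsUnique_skew a (c • x)).unique
    (existsUnique_skew a (c • x)).choose_spec.1 fun g => by
      simp only [map_smul, LinearMap.smul_apply, RingHom.id_apply,
        (existsUnique_skew a _).choose_spec.1 g]

theorem hall_skew (a f g : SymFun) : hall (skew a f) g = hall f (a * g) :=
  (existsUnique_skew a f).choose_spec.1 g

/-! ### Noncommutative symmetric functions -/

/-- The free associative algebra `ℚ⟨u_1, …, u_N⟩`. -/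
abbrev NCAlg (N : ℕ) : Type := FreeAlgebra ℚ (Fin N)

/-- The noncommutative elementary symmetric function `e_k(u)`, the sum of all products
`u_{i_1} ⋯ u_{i_k}` with `i_1 > ⋯ > i_k`. -/
def ncElem (N k : ℕ) : NCAlg N :=
  ∑ S ∈ powersetCard k (univ : Finset (Fin N)),
    ((S.sort (· ≥ ·)).map (FreeAlgebra.ι ℚ)).prod

/-- The noncommutative complete homogeneous symmetric function: `h_0(u) = 1` and
`h_k(u) = e_1(u) h_{k-1}(u) - e_2(u) h_{k-2}(u) + ⋯ + (-1)^{k-1} e_k(u)`. -/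
def ncComplete (N : ℕ) : ℕ → NCAlg N
  | 0 => 1
  | k + 1 => ∑ i : Fin (k + 1), (-1) ^ (i : ℕ) * (ncElem N (i + 1) * ncComplete N (k - i))

/-- `I` satisfies the commutation relation: the `e_k(u)` commute modulo `I`. -/
def SatisfiesCommutation {N : ℕ} (I : TwoSidedIdeal (NCAlg N)) : Prop :=
  ∀ k l : ℕ, 1 ≤ k → 1 ≤ l → ncElem N k * ncElem N l - ncElem N l * ncElem N k ∈ I

/-- The quotient algebra `U / I`. -/
abbrev Quo {N : ℕ} (I : TwoSidedIdeal (NCAlg N)) : Type := I.ringCon.Quotient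

/-- The quotient map `U → U / I`. -/
abbrev toQuo {N : ℕ} (I : TwoSidedIdeal (NCAlg N)) : NCAlg N →ₐ[ℚ] Quo I := I.ringCon.mkₐ ℚ

open scoped IsMulCommutative in
theorem existsUnique_ncMap {N : ℕ} (I : TwoSidedIdeal (NCAlg N)) (hI : SatisfiesCommutation I) :
    ∃! φ : SymFun →ₐ[ℚ] Quo I, ∀ k : ℕ, 1 ≤ k → φ (elem k) = toQuo I (ncElem N k) := by
  refine existsUnique_of_exists_of_unique ?_ fun φ ψ hφ hψ =>
    symFun_algHom_ext fun k hk => (hφ k hk).trans (hψ k hk).symm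
  let s : Set (Quo I) := Set.range fun k : ℕ+ => toQuo I (ncElem N k)
  have hs : ∀ x ∈ s, ∀ y ∈ s, x * y = y * x := by
    rintro _ ⟨k, rfl⟩ _ ⟨l, rfl⟩
    simp only
    rw [← map_mul, ← map_mul]
    exact (RingCon.eq _).2 ((TwoSidedIdeal.rel_iff _ _ _).2 (hI k l k.pos l.pos))
  have : IsMulCommutative (Algebra.adjoin ℚ s) := Algebra.isMulCommutative_adjoin ℚ hs
  let v : ℕ+ → Algebra.adjoin ℚ s := fun k =>
    ⟨toQuo I (ncElem N k), Algebra.subset_adjoin ⟨k, rfl⟩⟩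
  refine ⟨((Algebra.adjoin ℚ s).val.comp (MvPolynomial.aeval v)).comp
    elemEquiv.symm.toAlgHom, fun k hk => ?_⟩
  obtain ⟨k, rfl⟩ : ∃ j : ℕ+, (j : ℕ) = k := ⟨⟨k, hk⟩, rfl⟩
  change (Algebra.adjoin ℚ s).val (MvPolynomial.aeval v (elemEquiv.symm (elem k))) = _
  rw [elemEquiv_symm_elem, MvPolynomial.aeval_X]
  rfl

/-- The algebra homomorphism `φ : Sym → U / I` with `φ(e_k) = e_k(u)` for all `k ≥ 1`. -/
def ncMap {N : ℕ} (I : TwoSidedIdeal (NCAlg N)) (hI : SatisfiesCommutation I) :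
    SymFun →ₐ[ℚ] Quo I := (existsUnique_ncMap I hI).choose

theorem ncMap_elem {N : ℕ} (I : TwoSidedIdeal (NCAlg N)) (hI : SatisfiesCommutation I) (k : ℕ)
    (hk : 1 ≤ k) : ncMap I hI (elem k) = toQuo I (ncElem N k) :=
  (existsUnique_ncMap I hI).choose_spec.1 k hk

/-! ### The noncommutative Cauchy product -/

/-- `H(x_i, u) = ∑_ℓ x_i ^ ℓ h_ℓ(u)`. -/
def genH (N i : ℕ) : MvPowerSeries ℕ (NCAlg N) :=
  fun α => if α.support ⊆ {i} then ncComplete N (α i) else 0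

/-- The noncommutative Cauchy product `Ω(x, u) = H(x_0, u) H(x_1, u) H(x_2, u) ⋯`. The coefficient
of `x^α` is `h_{α_0}(u) h_{α_1}(u) ⋯ h_{α_m}(u)`, where `m` is the largest index in the support of
`α`; see `coeff_prod_genH` for the comparison with the finite products of the `H(x_i, u)`. -/
def cauchyNC (N : ℕ) : MvPowerSeries ℕ (NCAlg N) :=
  fun α => ((List.range (α.support.sup id + 1)).map fun i => ncComplete N (α i)).prod

theorem coeff_genH (N i : ℕ) (α : ℕ →₀ ℕ) : MvPowerSeries.coeff α (genH N i) =
    if α.support ⊆ {i} then ncComplete N (α i) else 0 := rfl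

theorem coeff_prod_genH_aux (N n : ℕ) (α : ℕ →₀ ℕ) :
    MvPowerSeries.coeff α ((List.range n).map (genH N)).prod =
      if α.support ⊆ range n then ((List.range n).map fun i => ncComplete N (α i)).prod
      else 0 := by
  classical
  induction n generalizing α with
  | zero =>
    simp only [List.range_zero, List.map_nil, List.prod_nil, MvPowerSeries.coeff_one,
      Finset.range_zero, Finset.subset_empty, Finsupp.support_eq_empty]
  | succ n ih =>
    rw [List.range_succ, List.map_append, List.prod_append, List.map_singleton,
      List.prod_singleton, MvPowerSeries.coeff_mul, List.map_append, List.prod_append,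
      List.map_singleton, List.prod_singleton]
    have hsum : α.erase n + Finsupp.single n (α n) = α := Finsupp.erase_add_single n α
    rw [Finset.sum_eq_single (α.erase n, Finsupp.single n (α n))]
    · rw [ih, coeff_genH, if_pos Finsupp.support_single_subset, Finsupp.single_eq_same]
      have h1 : ((List.range n).map fun i => ncComplete N ((α.erase n) i)) =
          (List.range n).map fun i => ncComplete N (α i) :=
        List.map_congr_left fun i hi => by
          rw [Finsupp.erase_ne (List.mem_range.1 hi).ne]
      have h2 : (α.erase n).support ⊆ range n ↔ α.support ⊆ range (n + 1) := by
        rw [Finsupp.support_erase, Finset.range_add_one, Finset.subset_insert_iff]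
      simp only [h1, h2, ite_mul, zero_mul]
    · rintro ⟨β, γ⟩ hp hne
      have hp' : β + γ = α := HasAntidiagonal.mem_antidiagonal.1 hp
      change MvPowerSeries.coeff β _ * MvPowerSeries.coeff γ _ = 0
      rw [ih, coeff_genH]
      split_ifs with h1 h2 <;> try simp only [zero_mul, mul_zero]
      exfalso
      apply hne
      have hβ : β n = 0 := by
        by_contra h
        exact absurd (mem_range.1 (h1 (Finsupp.mem_support_iff.2 h))) (lt_irrefl _)
      have hγ : ∀ i, i ≠ n → γ i = 0 := fun i hi => by
        by_contra h
        exact hi (by simpa using h2 (Finsupp.mem_support_iff.2 h))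
      refine Prod.ext ?_ ?_
      · ext i
        rcases eq_or_ne i n with rfl | hi
        · simp [hβ]
        · simp [← hp', Finsupp.erase_ne hi, hγ i hi]
      · ext i
        rcases eq_or_ne i n with rfl | hi
        · simp [← hp', hβ]
        · simp [Finsupp.single_eq_of_ne hi, hγ i hi]
    · intro h
      exact absurd (HasAntidiagonal.mem_antidiagonal.2 hsum) h

/-- The coefficients of the finite products `H(x_0, u) ⋯ H(x_{n-1}, u)` are eventually those of
the noncommutative Cauchy product. -/
theorem coeff_prod_genH (N n : ℕ) (α : ℕ →₀ ℕ) (hn : α.support ⊆ range n) :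
    MvPowerSeries.coeff α ((List.range n).map (genH N)).prod =
      MvPowerSeries.coeff α (cauchyNC N) := by
  rw [coeff_prod_genH_aux, if_pos hn]
  have pad : ∀ m k : ℕ, α.support ⊆ range m →
      ((List.range (m + k)).map fun i => ncComplete N (α i)).prod =
        ((List.range m).map fun i => ncComplete N (α i)).prod := by
    intro m k hm
    induction k with
    | zero => rfl
    | succ k ih =>
      rw [← add_assoc, List.range_succ, List.map_append, List.prod_append, ih,
        List.map_singleton, List.prod_singleton]
      have : α (m + k) = 0 := by
        by_contra h
        have := mem_range.1 (hm (Finsupp.mem_support_iff.2 h))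
        omega
      rw [this, ncComplete, mul_one]
  have hs : α.support ⊆ range (α.support.sup id + 1) := fun i hi =>
    mem_range.2 (Nat.lt_succ_of_le (Finset.le_sup (f := id) hi))
  change _ = ((List.range (α.support.sup id + 1)).map fun i => ncComplete N (α i)).prod
  rw [← pad n (α.support.sup id + 1) hn, ← pad (α.support.sup id + 1) n hs, add_comm n]

/-- `F` sums to `G` in the sense of formal power series: every coefficient is a finite sum. -/
def HasFormalSum {ι R : Type*} [Semiring R] (F : ι → MvPowerSeries ℕ R)
    (G : MvPowerSeries ℕ R) : Prop :=
  ∀ α, {i | MvPowerSeries.coeff α (F i) ≠ 0}.Finite ∧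
    MvPowerSeries.coeff α G = ∑ᶠ i, MvPowerSeries.coeff α (F i)

/-- Congruence modulo `I[[x]]`, the set of power series with all coefficients in `I`. -/
def SeriesCongr {N : ℕ} (I : TwoSidedIdeal (NCAlg N)) (A B : MvPowerSeries ℕ (NCAlg N)) : Prop :=
  ∀ α, MvPowerSeries.coeff α (A - B) ∈ I

/-- A power series in `x` over `ℚ`, regarded as a power series over `U`. -/
abbrev toNCSeries (N : ℕ) (s : MvPowerSeries ℕ ℚ) : MvPowerSeries ℕ (NCAlg N) :=
  MvPowerSeries.map (algebraMap ℚ (NCAlg N)) s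

/-! ### The pairing with words -/

/-- `U^*`, the free `ℤ`-module generated by the words on the alphabet. -/
abbrev WordModule (N : ℕ) : Type := FreeMonoid (Fin N) →₀ ℤ

/-- The pairing of `U` and `U^*` with `⟨u_w, v⟩ = δ_{w,v}`. -/
def pair {N : ℕ} (z : NCAlg N) (γ : WordModule N) : ℚ :=
  γ.sum fun w c => (c : ℚ) * (FreeAlgebra.equivMonoidAlgebraFreeMonoid z).coeff w

/-- The coefficientwise extension of the pairing to `U[[x]]` and `U^*`. -/
def pairSeries {N : ℕ} (Z : MvPowerSeries ℕ (NCAlg N)) (γ : WordModule N) : MvPowerSeries ℕ ℚ :=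
  fun α => pair (MvPowerSeries.coeff α Z) γ

/-- `I^⊥`, the elements of `U^*` that pair to zero with every element of `I`. -/
def perp {N : ℕ} (I : TwoSidedIdeal (NCAlg N)) : Set (WordModule N) :=
  {γ | ∀ z ∈ I, pair z γ = 0}

/-- The descent set of a word `w_1 ⋯ w_d`: the `i ∈ [d-1]` with `w_i > w_{i+1}`. -/
def descents {N : ℕ} (w : List (Fin N)) : Set ℕ :=
  {i | ∃ (j : ℕ) (h : j + 1 < w.length), i = j + 1 ∧ w[j + 1] < w[j]}

/-- The fundamental quasisymmetric function `F_{d,S}`: the sum of `x_{i_1} ⋯ x_{i_d}` over all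
`i_1 ≤ ⋯ ≤ i_d` such that `i_j < i_{j+1}` for `j ∈ S`. The coefficient of `x^α` is the number of
such sequences with content `α`. -/
def fundamental (d : ℕ) (S : Set ℕ) : MvPowerSeries ℕ ℚ := fun α =>
  (Nat.card {i : Fin d → ℕ // Monotone i ∧
    (∀ (j : ℕ) (h : j + 1 < d), j + 1 ∈ S → i ⟨j, by omega⟩ < i ⟨j + 1, h⟩) ∧
    ∑ j, Finsupp.single (i j) 1 = α} : ℚ)

/-- `F_γ = ∑_w γ_w F_{d, Des(w)}`, where `d` is the length of `w`. -/
def seriesOf {N : ℕ} (γ : WordModule N) : MvPowerSeries ℕ ℚ :=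
  γ.sum fun w c => (c : ℚ) • fundamental w.toList.length (descents w.toList)

end NCSkew

end

noncomputable section

namespace NCSkew

open Finset

/-! ### Symmetry of the Hall inner product -/

/-! Everything rests on the coefficient of x^α in Ω. Modulo `I` the h_k(u) are the images φ(h_k),
because both families satisfy the same recursion over the e_k; hence that coefficient represents
φ(h_α), with h_α = ∏ h_{α_i} (`toQuo_coeff_cauchyNC`). Dually, pairing a symmetric function with h_α
extracts its coefficient of x^α (`hall_completePart_parOf`).

For the congruence, the coefficient of x^α in f_μ^⊥ g_λ is ⟨g_λ, f_μ h_α⟩, which by duality is the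
coordinate of f_μ h_α at f_λ (`coeff_skew_dual`). The claim in degree α is therefore φ applied to
the finite expansion of f_μ h_α in the basis f.

For F_γ, one first works in the free algebra. By a sign-cancelling argument h_k(u) is the sum of the
weakly increasing words of length k. So w occurs in h_{α_0}(u) h_{α_1}(u) ⋯, with coefficient 1,
exactly when cutting w into blocks of sizes α_i leaves no descent inside a block. That indicator is
also the coefficient of x^α in the fundamental quasisymmetric function of w (`coeff_fundamental`),
so F_γ = ⟨Ω, γ⟩ for every γ. If γ ∈ I^⊥, the pairing factors through U/I. Since h_α depends only on
the multiset of parts of α, F_γ is symmetric, and linearity gives ⟨F_γ, s⟩ = ⟨z, γ⟩ for any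
representative z of φ(s) (`hall_seriesOf`). Taking s = f_μ h_α and s = f_μ f_λ yields the two
formulas.

The Hall form is defined asymmetrically, so its symmetry must be proved: ⟨h_λ, h_μ⟩ counts matrices
over ℕ with prescribed row and column sums, and transposition exchanges the two conditions. -/

theorem shape_parOf (α : ℕ →₀ ℕ) : (parOf α).2.parts = shape α := rfl

theorem hall_completePart (s : SymFun) (lam : Par) :
    hall s (completePart lam) = coeffFun (expo lam) s := by
  have : hall.flip (completePart lam) = coeffFun (expo lam) := monoBasis.ext fun mu => by
    rw [LinearMap.flip_apply, monoBasis_apply, hall_mono_complete, coeffFun_apply,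
      coeff_expo_mono]
    exact if_congr eq_comm rfl rfl
  exact DFunLike.congr_fun this s

theorem hall_completePart_parOf (s : SymFun) (α : ℕ →₀ ℕ) :
    hall s (completePart (parOf α)) = coeffFun α s := by
  rw [hall_completePart]
  exact coeff_eq_of_shape s (shape_expo (parOf α))

/-- Padding with h_0 = 1 is harmless. The freedom in `T` lets two exponent vectors share one index
set, and lets the product run over an initial segment of ℕ as Ω does. -/
theorem completePart_parOf (α : ℕ →₀ ℕ) {T : Finset ℕ} (hT : α.support ⊆ T) :
    completePart (parOf α) = ∏ i ∈ T, complete (α i) := by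
  rw [← Finset.prod_subset hT fun i _ hi => by
    rw [Finsupp.notMem_support_iff.1 hi, complete_zero]]
  rw [completePart, shape_parOf, shape, Multiset.map_map]
  rfl

/-- The transpose of a finitely supported matrix. -/
def transpose (l : ℕ →₀ ℕ →₀ ℕ) : ℕ →₀ ℕ →₀ ℕ :=
  (l.uncurry.equivMapDomain (Equiv.prodComm ℕ ℕ)).curry

theorem transpose_apply (l : ℕ →₀ ℕ →₀ ℕ) (i j : ℕ) : transpose l i j = l j i := by
  simp [transpose, Finsupp.curry_apply, Finsupp.equivMapDomain_apply]

/-- The matrices over `ℕ` with row sums `β` and column sums `α`. -/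
def matrices (T : Finset ℕ) (β α : ℕ →₀ ℕ) : Finset (ℕ →₀ ℕ →₀ ℕ) :=
  (finsuppAntidiag T α).filter fun l => ∀ i ∈ T, (l i).degree = β i

/-- Expanding the product means choosing a monomial of degree β i from the i-th factor; these
exponent vectors are the rows of a matrix, and their sum α lists its column sums. -/
theorem coeffFun_prod_complete (T : Finset ℕ) (α β : ℕ →₀ ℕ) :
    coeffFun α (∏ i ∈ T, complete (β i)) = (matrices T β α).card := by
  classical
  have h1 : ((∏ i ∈ T, complete (β i) : SymFun) : MvPowerSeries ℕ ℚ) =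
      ∏ i ∈ T, (complete (β i) : MvPowerSeries ℕ ℚ) := map_prod SymFun.val _ _
  rw [coeffFun_apply, h1, MvPowerSeries.coeff_prod, matrices, Finset.card_filter, Nat.cast_sum]
  refine Finset.sum_congr rfl fun l _ => ?_
  simp only [coeff_complete, Finset.prod_boole, Nat.cast_ite, Nat.cast_one, Nat.cast_zero]

/-- Transposition is injective and exchanges the row and column conditions. One inequality suffices,
since the hypotheses are symmetric in α and β. -/
theorem card_matrices_le {T : Finset ℕ} {α β : ℕ →₀ ℕ} (hα : α.support ⊆ T)
    (hβ : β.support ⊆ T) : (matrices T β α).card ≤ (matrices T α β).card := by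
  classical
  refine Finset.card_le_card_of_injOn transpose (fun l hl => ?_) fun l _ m _ h => ?_
  · obtain ⟨h1, h2⟩ := Finset.mem_filter.1 hl
    obtain ⟨h3, h4⟩ := mem_finsuppAntidiag.1 h1
    have hrow : ∀ i, i ∉ T → l i = 0 := fun i hi =>
      Finsupp.notMem_support_iff.1 fun h => hi (h4 h)
    have hcol : ∀ j, ∑ i ∈ T, l i j = α j := fun j => by
      rw [← h3, Finsupp.finsetSum_apply]
    -- Membership in `matrices` confines only the rows to `T`. The columns are confined because a
    -- sum of natural numbers equal to α j = 0 has all its terms zero.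
    have hzero : ∀ i j, j ∉ T → l i j = 0 := fun i j hj => by
      by_cases hi : i ∈ T
      · have h5 : α j = 0 := Finsupp.notMem_support_iff.1 fun h => hj (hα h)
        exact Finset.sum_eq_zero_iff.1 ((hcol j).trans h5) i hi
      · rw [hrow i hi, Finsupp.zero_apply]
    refine Finset.mem_coe.2 (Finset.mem_filter.2 ⟨mem_finsuppAntidiag.2 ⟨?_, ?_⟩, fun j _ => ?_⟩)
    · ext i
      simp only [Finsupp.finsetSum_apply, transpose_apply]
      by_cases hi : i ∈ T
      · rw [← h2 i hi, Finsupp.degree_apply]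
        exact (Finset.sum_subset (fun j hj => by
          by_contra h
          exact Finsupp.mem_support_iff.1 hj (hzero i j h))
          fun j _ hj => Finsupp.notMem_support_iff.1 hj).symm
      · rw [hrow i hi, Finsupp.notMem_support_iff.1 fun h => hi (hβ h)]
        simp
    · intro j hj
      by_contra h
      refine Finsupp.mem_support_iff.1 hj ?_
      ext i
      rw [transpose_apply, hzero i j h, Finsupp.zero_apply]
    · rw [← hcol j, Finsupp.degree_apply]
      simp only [transpose_apply]
      refine Finset.sum_subset (fun i hi => ?_) fun i _ hi => ?_
      · by_contra h
        refine Finsupp.mem_support_iff.1 hi ?_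
        rw [transpose_apply, hrow i h, Finsupp.zero_apply]
      · rw [← transpose_apply]
        exact Finsupp.notMem_support_iff.1 hi
  · ext i j
    rw [← transpose_apply l, h, transpose_apply]

theorem hall_completePart_comm (lam mu : Par) :
    hall (completePart lam) (completePart mu) = hall (completePart mu) (completePart lam) := by
  classical
  have hT := subset_union_left (s₁ := (expo lam).support) (s₂ := (expo mu).support)
  have hT' := subset_union_right (s₁ := (expo lam).support) (s₂ := (expo mu).support)
  -- Rewriting backwards also changes the exponents at which coefficients are read; the later uses
  -- of `parOf_expo` undo this.
  rw [hall_completePart, hall_completePart, ← parOf_expo lam, ← parOf_expo mu,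
    completePart_parOf _ hT, completePart_parOf _ hT', parOf_expo, parOf_expo,
    coeffFun_prod_complete, coeffFun_prod_complete]
  exact congrArg _ (le_antisymm (card_matrices_le hT' hT) (card_matrices_le hT hT'))

theorem hall_comm (f g : SymFun) : hall f g = hall g f := by
  have : hall = hall.flip := completeBasis.ext fun lam => completeBasis.ext fun mu => by
    rw [completeBasis_apply, completeBasis_apply, LinearMap.flip_apply, hall_completePart_comm]
  conv_lhs => rw [this, LinearMap.flip_apply]

/-- Both sides are linear in `s` and agree on the basis `g` by duality. -/
theorem repr_eq_hall {f g : Module.Basis Par ℚ SymFun}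
    (hfg : ∀ lam mu, hall (f lam) (g mu) = if lam = mu then 1 else 0) (s : SymFun) (lam : Par) :
    g.repr s lam = hall (f lam) s := by
  have : hall (f lam) = g.coord lam := g.ext fun mu => by
    rw [hfg, Module.Basis.coord_apply, Module.Basis.repr_self, Finsupp.single_apply]
    exact if_congr eq_comm rfl rfl
  rw [this, Module.Basis.coord_apply]

/-! ### Noncommutative complete homogeneous symmetric functions modulo the ideal -/

/-- This puts the relation ∑ (-1)^i e_i h_{n-i} = 0, solved for its term i = 0, into the exact form
of the recursion defining `ncComplete`. -/
theorem complete_succ (k : ℕ) : complete (k + 1) =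
    ∑ i : Fin (k + 1), (-1) ^ (i : ℕ) * (elem (i + 1) * complete (k - i)) := by
  have h := elem_complete (k + 1) k.succ_ne_zero
  rw [Finset.Nat.sum_antidiagonal_eq_sum_range_succ_mk, Finset.sum_range_succ'] at h
  simp only [pow_zero, elem_zero, one_mul, Nat.sub_zero, Nat.add_sub_add_right] at h
  rw [Fin.sum_univ_eq_sum_range fun i => (-1) ^ i * (elem (i + 1) * complete (k - i)),
    eq_neg_of_add_eq_zero_right h, ← Finset.sum_neg_distrib]
  refine Finset.sum_congr rfl fun i _ => ?_
  rw [pow_succ]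
  ring

section Quotient

variable {N : ℕ} (I : TwoSidedIdeal (NCAlg N)) (hI : SatisfiesCommutation I)

theorem ncMap_complete (k : ℕ) : ncMap I hI (complete k) = toQuo I (ncComplete N k) := by
  induction k using Nat.strong_induction_on with
  | _ k ih =>
    cases k with
    | zero => rw [complete_zero, map_one, ncComplete, map_one]
    | succ k =>
      rw [complete_succ, ncComplete, map_sum, map_sum]
      refine Finset.sum_congr rfl fun i _ => ?_
      simp only [map_mul, map_pow, map_neg, map_one]
      rw [ncMap_elem I hI _ (Nat.le_add_left 1 i), ih _ (by omega)]

/-- The ordered product of the h_{α_i}(u) becomes, modulo `I`, the image of a product in the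
commutative algebra `Sym`, so the order of the factors no longer matters. -/
theorem toQuo_coeff_cauchyNC (α : ℕ →₀ ℕ) :
    toQuo I (MvPowerSeries.coeff α (cauchyNC N)) = ncMap I hI (completePart (parOf α)) := by
  have hs : α.support ⊆ range (α.support.sup id + 1) := fun i hi =>
    mem_range.2 (Nat.lt_succ_of_le (Finset.le_sup (f := id) hi))
  rw [completePart_parOf α hs, Finset.prod_range fun i => complete (α i), ← List.prod_ofFn,
    map_list_prod, List.map_ofFn]
  change toQuo I ((List.range (α.support.sup id + 1)).map fun i => ncComplete N (α i)).prod = _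
  rw [map_list_prod, List.map_map]
  congr 1
  apply List.ext_getElem
  · simp
  · intro i h1 h2
    simp only [List.getElem_map, List.getElem_range, List.getElem_ofFn, Function.comp_apply]
    exact (ncMap_complete I hI _).symm

theorem toQuo_eq_iff (a b : NCAlg N) : toQuo I a = toQuo I b ↔ a - b ∈ I :=
  (RingCon.eq _).trans (TwoSidedIdeal.rel_iff _ _ _)

end Quotient

/-! ### Coefficients of words -/

section Words

variable {N : ℕ}

/-- The coefficient of the word `w`. -/
def wordCoeff (w : List (Fin N)) : NCAlg N →ₗ[ℚ] ℚ where
  toFun z := (FreeAlgebra.equivMonoidAlgebraFreeMonoid z).coeff (FreeMonoid.ofList w)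
  map_add' a b := by rw [map_add, MonoidAlgebra.coeff_add, Finsupp.add_apply]
  map_smul' c a := by rw [map_smul, MonoidAlgebra.coeff_smul_apply, RingHom.id_apply]

theorem wordCoeff_apply (w : List (Fin N)) (z : NCAlg N) : wordCoeff w z =
    (FreeAlgebra.equivMonoidAlgebraFreeMonoid z).coeff (FreeMonoid.ofList w) := rfl

theorem wordCoeff_one (w : List (Fin N)) : wordCoeff w 1 = if w = [] then 1 else 0 := by
  classical
  rw [wordCoeff_apply, map_one, MonoidAlgebra.one_def, MonoidAlgebra.coeff_single,
    Finsupp.single_apply]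
  exact if_congr eq_comm rfl rfl

theorem wordCoeff_prod (v w : List (Fin N)) :
    wordCoeff w (v.map (FreeAlgebra.ι ℚ)).prod = if v = w then 1 else 0 := by
  classical
  have : FreeAlgebra.equivMonoidAlgebraFreeMonoid (v.map (FreeAlgebra.ι ℚ)).prod =
      MonoidAlgebra.of ℚ (FreeMonoid (Fin N)) (FreeMonoid.ofList v) := by
    induction v with
    | nil => rw [List.map_nil, List.prod_nil, map_one, FreeMonoid.ofList_nil, map_one]
    | cons a v ih =>
      rw [List.map_cons, List.prod_cons, map_mul, ih, FreeMonoid.ofList_cons, map_mul]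
      simp [FreeAlgebra.equivMonoidAlgebraFreeMonoid]
  rw [wordCoeff_apply, this, MonoidAlgebra.of_apply, MonoidAlgebra.coeff_single,
    Finsupp.single_apply]
  exact if_congr FreeMonoid.ofList.injective.eq_iff rfl rfl

/-- In a free monoid the factorizations of a word into two are exactly its cuts into a prefix and a
suffix. -/
theorem wordCoeff_mul (w : List (Fin N)) (a b : NCAlg N) : wordCoeff w (a * b) =
    ∑ i ∈ range (w.length + 1), wordCoeff (w.take i) a * wordCoeff (w.drop i) b := by
  classical
  let split : ℕ → FreeMonoid (Fin N) × FreeMonoid (Fin N) := fun i =>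
    (FreeMonoid.ofList (w.take i), FreeMonoid.ofList (w.drop i))
  have hinj : Set.InjOn split (range (w.length + 1)) := fun i hi j hj h => by
    have := congrArg (fun p => (FreeMonoid.toList p.1).length) h
    simp only [split, FreeMonoid.toList_ofList, List.length_take] at this
    have h1 := mem_range.1 hi
    have h2 := mem_range.1 hj
    omega
  rw [wordCoeff_apply, map_mul, MonoidAlgebra.coeff_mul_antidiag _ _ _
    ((range (w.length + 1)).image split), Finset.sum_image hinj]
  · rfl
  · rintro ⟨u, v⟩
    rw [Finset.mem_image]
    constructor
    · rintro ⟨i, -, h⟩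
      rw [← h]
      simp only [split, ← FreeMonoid.ofList_append, List.take_append_drop]
    · intro h
      have h' : w = u.toList ++ v.toList := by
        rw [← FreeMonoid.toList_mul, h, FreeMonoid.toList_ofList]
      refine ⟨u.toList.length, mem_range.2 ?_, ?_⟩
      · rw [h', List.length_append]; omega
      · simp only [split]
        rw [h']
        simp

theorem wordCoeff_ncElem (k : ℕ) (w : List (Fin N)) : wordCoeff w (ncElem N k) =
    if w.length = k ∧ w.Pairwise (· > ·) then 1 else 0 := by
  classical
  rw [ncElem, map_sum]
  simp only [wordCoeff_prod]
  have key : ∀ S : Finset (Fin N), S.sort (· ≥ ·) = w ↔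
      S = w.toFinset ∧ w.Pairwise (· > ·) := by
    intro S
    constructor
    · rintro rfl
      exact ⟨(Finset.sort_toFinset _ _).symm, (Finset.sortedGT_sort S).pairwise⟩
    · rintro ⟨rfl, h⟩
      refine List.Perm.eq_of_pairwise' (r := (· ≥ ·)) (Finset.pairwise_sort _ _)
        (h.imp fun h => h.le) ?_
      refine (List.perm_ext_iff_of_nodup (Finset.sort_nodup _ _) (h.imp fun h => h.ne')).2 ?_
      simp
  simp only [key, ite_and, Finset.sum_ite_eq', mem_powersetCard, subset_univ, true_and]
  by_cases h : w.Pairwise (· > ·)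
  · rw [List.toFinset_card_of_nodup (h.imp fun h => h.ne')]
  · simp [h]

/-- The alternating sum over the splittings of a nonempty word into a strictly decreasing and a
weakly increasing part vanishes. -/
theorem sum_split_eq_zero (w : List (Fin N)) (hw : w ≠ []) :
    ∑ i ∈ range (w.length + 1), (-1 : ℚ) ^ i *
      ((if (w.take i).Pairwise (· > ·) then 1 else 0) *
        if (w.drop i).Pairwise (· ≤ ·) then 1 else 0) = 0 := by
  induction w with
  | nil => exact absurd rfl hw
  | cons a v ih =>
    cases v with
    | nil => simp [Finset.sum_range_succ]
    | cons b v =>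
      have ih := ih (by simp)
      have hdec : ∀ l : List (Fin N), (a :: b :: l).Pairwise (· > ·) ↔
          a > b ∧ (b :: l).Pairwise (· > ·) := fun l => by
        rw [← List.isChain_iff_pairwise, ← List.isChain_iff_pairwise, List.isChain_cons_cons]
      have hinc : ∀ l : List (Fin N), (a :: b :: l).Pairwise (· ≤ ·) ↔
          a ≤ b ∧ (b :: l).Pairwise (· ≤ ·) := fun l => by
        rw [← List.isChain_iff_pairwise, ← List.isChain_iff_pairwise, List.isChain_cons_cons]
      -- Isolate the cuts at 0 and 1. If a > b, the cut at 0 contributes nothing and the other cuts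
      -- reproduce, with opposite sign, those of the word without `a`. If a ≤ b, only the cuts at 0
      -- and 1 can contribute, and they cancel.
      rw [List.length_cons, Finset.sum_range_succ', Finset.sum_range_succ']
      rw [List.length_cons, Finset.sum_range_succ'] at ih
      simp only [List.take_succ_cons, List.drop_succ_cons, hdec, List.take_zero, List.drop_zero,
        List.Pairwise.nil, if_true, hinc, pow_zero, one_mul, zero_add, pow_one,
        List.pairwise_singleton] at ih ⊢
      rcases lt_or_ge b a with h | h
      · simp only [gt_iff_lt] at ih
        simp only [gt_iff_lt, h, true_and, not_le.2 h, false_and, if_false, add_zero]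
        simp only [pow_succ _ (_ + 1), mul_neg_one, neg_mul, Finset.sum_neg_distrib]
        rw [List.length_cons]
        linear_combination -ih
      · simp only [gt_iff_lt, not_lt.2 h, h, true_and, false_and, if_false, zero_mul, mul_zero,
          Finset.sum_const_zero]
        ring

/-- By induction the recursion yields the terms of `sum_split_eq_zero` with nonempty prefix, sign
reversed; their sum is thus the term with empty prefix, which tests whether `w` is weakly
increasing. -/
theorem wordCoeff_ncComplete (k : ℕ) (w : List (Fin N)) : wordCoeff w (ncComplete N k) =
    if w.length = k ∧ w.Pairwise (· ≤ ·) then 1 else 0 := by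
  induction k using Nat.strong_induction_on generalizing w with
  | _ k ih =>
    cases k with
    | zero =>
      rw [ncComplete, wordCoeff_one]
      refine if_congr ⟨?_, fun h => List.length_eq_zero_iff.1 h.1⟩ rfl rfl
      rintro rfl
      simp
    | succ k =>
      have hterm : ∀ i : Fin (k + 1),
          wordCoeff w ((-1) ^ (i : ℕ) * (ncElem N (i + 1) * ncComplete N (k - i))) =
          if w.length = k + 1 then (-1) ^ (i : ℕ) *
            ((if (w.take (i + 1)).Pairwise (· > ·) then 1 else 0) *
              if (w.drop (i + 1)).Pairwise (· ≤ ·) then 1 else 0) else 0 := by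
        intro i
        have hi := i.2
        have hsmul : ((-1) ^ (i : ℕ) * (ncElem N (i + 1) * ncComplete N (k - i)) : NCAlg N) =
            ((-1 : ℚ) ^ (i : ℕ)) • (ncElem N (i + 1) * ncComplete N (k - i)) := by
          rw [Algebra.smul_def, map_pow, map_neg, map_one]
        rw [hsmul, map_smul, smul_eq_mul, wordCoeff_mul]
        simp only [wordCoeff_ncElem, ih (k - i) (by omega), List.length_take, List.length_drop]
        by_cases hw : w.length = k + 1
        · rw [if_pos hw, Finset.sum_eq_single ((i : ℕ) + 1)]
          · rw [hw]
            have h1 : min ((i : ℕ) + 1) (k + 1) = i + 1 := by omega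
            have h2 : k + 1 - ((i : ℕ) + 1) = k - i := by omega
            simp only [h1, h2, true_and]
          · intro j hj hne
            have hj := mem_range.1 hj
            rw [if_neg (by omega), zero_mul]
          · intro h
            exact absurd (mem_range.2 (by omega)) h
        -- A contributing cut needs parts of lengths i + 1 and k - i, hence a word of length k + 1.
        · rw [if_neg hw, Finset.sum_eq_zero, mul_zero]
          intro j hj
          have hj := mem_range.1 hj
          by_cases h1 : min j w.length = i + 1
          · rw [if_neg (c := w.length - j = k - i ∧ _) (by omega), mul_zero]
          · rw [if_neg (by omega), zero_mul]
      rw [ncComplete, map_sum, Finset.sum_congr rfl fun i _ => hterm i]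
      by_cases hw : w.length = k + 1
      · simp only [hw, if_true, true_and]
        have h := sum_split_eq_zero w (by rintro rfl; simp at hw)
        rw [hw, Finset.sum_range_succ'] at h
        simp only [pow_zero, List.take_zero, List.Pairwise.nil, if_true, List.drop_zero,
          one_mul, pow_succ, mul_neg_one, neg_mul, Finset.sum_neg_distrib] at h
        rw [Fin.sum_univ_eq_sum_range fun i => (-1 : ℚ) ^ i *
            ((if (w.take (i + 1)).Pairwise (· > ·) then 1 else 0) *
              if (w.drop (i + 1)).Pairwise (· ≤ ·) then 1 else 0)]
        linear_combination -h
      · simp [hw]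

/-- The weakly increasing sequence with `α i` entries equal to `i`, for `i < n`. -/
def blockSeq (α : ℕ → ℕ) (n : ℕ) : List ℕ := (List.range n).flatMap fun i => List.replicate (α i) i

theorem blockSeq_succ (α : ℕ → ℕ) (n : ℕ) :
    blockSeq α (n + 1) = blockSeq α n ++ List.replicate (α n) n := by
  simp [blockSeq, List.range_succ]

theorem lt_of_mem_blockSeq {α : ℕ → ℕ} {n i : ℕ} (h : i ∈ blockSeq α n) : i < n := by
  simp only [blockSeq, List.mem_flatMap, List.mem_range, List.mem_replicate] at h
  obtain ⟨j, hj, -, rfl⟩ := h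
  exact hj

theorem pairwise_blockSeq (α : ℕ → ℕ) (n : ℕ) : (blockSeq α n).Pairwise (· ≤ ·) := by
  induction n with
  | zero => simp [blockSeq]
  | succ n ih =>
    rw [blockSeq_succ, List.pairwise_append]
    refine ⟨ih, List.pairwise_replicate.2 (Or.inr le_rfl), fun a ha b hb => ?_⟩
    rw [List.eq_of_mem_replicate hb]
    exact (lt_of_mem_blockSeq ha).le

theorem count_blockSeq (α : ℕ → ℕ) (n i : ℕ) :
    (blockSeq α n).count i = if i < n then α i else 0 := by
  induction n with
  | zero => simp [blockSeq]
  | succ n ih =>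
    rw [blockSeq_succ, List.count_append, ih, List.count_replicate]
    rcases lt_trichotomy i n with h | rfl | h
    · simp [h, h.ne', Nat.lt_succ_of_lt h]
    · simp
    · simp [h.ne, not_lt.2 h.le, not_lt.2 (Nat.succ_le_of_lt h)]

/-- The lexicographic order on pairs of a position and a letter. -/
def LexLE (p q : ℕ × Fin N) : Prop := p.1 < q.1 ∨ p.1 = q.1 ∧ p.2 ≤ q.2

/-- Labelling each letter with its factor turns "weakly increasing inside each block, unconstrained
between blocks" into sortedness for `LexLE`. The length condition is stated separately because `zip`
truncates. -/
theorem wordCoeff_prod_ncComplete (α : ℕ → ℕ) (n : ℕ) (w : List (Fin N)) :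
    wordCoeff w ((List.range n).map fun i => ncComplete N (α i)).prod =
      open Classical in
      if (blockSeq α n).length = w.length ∧ ((blockSeq α n).zip w).Pairwise LexLE
      then 1 else 0 := by
  classical
  induction n generalizing w with
  | zero =>
    rw [List.range_zero, List.map_nil, List.prod_nil, wordCoeff_one]
    refine if_congr ?_ rfl rfl
    cases w <;> simp [blockSeq]
  | succ n ih =>
    rw [List.range_succ, List.map_append, List.prod_append, List.map_singleton,
      List.prod_singleton, wordCoeff_mul, blockSeq_succ]
    simp only [ih, wordCoeff_ncComplete, List.length_append, List.length_replicate,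
      List.length_take, List.length_drop]
    by_cases hw : (blockSeq α n).length + α n = w.length
    -- Lengths force the cut: the last factor must take exactly the final α n letters.
    · rw [Finset.sum_eq_single (blockSeq α n).length]
      · set s := blockSeq α n with hs
        obtain ⟨u, v, rfl, hu, hv⟩ : ∃ u v, w = u ++ v ∧ s.length = u.length ∧ v.length = α n :=
          ⟨w.take s.length, w.drop s.length, (List.take_append_drop _ _).symm,
            by rw [List.length_take]; omega, by rw [List.length_drop]; omega⟩
        have hzip : (List.replicate (α n) n).zip v = v.map (Prod.mk n) := by
          rw [← hv]
          apply List.ext_getElem <;> simp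
        have hcross : ∀ a ∈ s.zip u, ∀ b ∈ v.map (Prod.mk n), LexLE a b := by
          rintro ⟨i, x⟩ ha b hb
          obtain ⟨y, -, rfl⟩ := List.mem_map.1 hb
          exact Or.inl (lt_of_mem_blockSeq (List.of_mem_zip ha).1)
        have hblock : (v.map (Prod.mk n)).Pairwise LexLE ↔ v.Pairwise (· ≤ ·) := by
          rw [List.pairwise_map]
          simp [LexLE]
        simp only [List.zip_append hu, List.pairwise_append, hzip, hblock]
        simp only [hu, List.take_left, List.drop_left, List.length_append, hv, min_eq_left (Nat.le_add_right _ _), true_and,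
          Nat.add_sub_cancel_left]
        simp only [eq_true hcross, and_true, ite_and, mul_ite, mul_one, mul_zero]
        split_ifs <;> rfl
      · intro j hj hne
        have hj := mem_range.1 hj
        rw [if_neg (by omega), zero_mul]
      · intro h
        exact absurd (mem_range.2 (by omega)) h
    · rw [if_neg (fun h => hw h.1), Finset.sum_eq_zero]
      intro j hj
      have hj := mem_range.1 hj
      by_cases h1 : (blockSeq α n).length = min j w.length
      · rw [if_neg (c := w.length - j = α n ∧ _) (by omega), mul_zero]
      · rw [if_neg (by omega), zero_mul]

end Words

/-! ### Fundamental quasisymmetric functions -/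

section Fundamental

variable {N : ℕ}

/-- Transitivity lets sortedness be tested on adjacent letters, which is where descents live. -/
instance : IsTrans (ℕ × Fin N) LexLE where
  trans p q r h1 h2 := by
    unfold LexLE at *
    omega

/-- Between adjacent positions, `LexLE` says that the index grows strictly, or stays equal while the
letters do not descend. -/
theorem pairwise_zip_ofFn_iff (w : List (Fin N)) (i : Fin w.length → ℕ) :
    ((List.ofFn i).zip w).Pairwise LexLE ↔ Monotone i ∧
      ∀ (j : ℕ) (h : j + 1 < w.length), j + 1 ∈ descents w → i ⟨j, by omega⟩ < i ⟨j + 1, h⟩ := by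
  have hlen : ((List.ofFn i).zip w).length = w.length := by simp
  constructor
  · intro h
    rw [List.pairwise_iff_getElem] at h
    simp only [hlen, List.getElem_zip, List.getElem_ofFn, LexLE] at h
    refine ⟨fun j k hjk => ?_, fun j hj hdes => ?_⟩
    · rcases hjk.eq_or_lt with rfl | hjk
      · exact le_rfl
      · rcases h j k j.2 k.2 hjk with h1 | h1
        · exact h1.le
        · exact h1.1.le
    · obtain ⟨j', hj', h1, h2⟩ := hdes
      obtain rfl : j = j' := by omega
      rcases h j (j + 1) (by omega) hj (by omega) with h3 | h3
      · exact h3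
      · exact absurd h3.2 (not_le.2 h2)
  · rintro ⟨h1, h2⟩
    rw [← List.isChain_iff_pairwise, List.isChain_iff_getElem]
    intro j hj
    rw [hlen] at hj
    simp only [List.getElem_zip, List.getElem_ofFn, LexLE]
    have hle : i ⟨j, by omega⟩ ≤ i ⟨j + 1, hj⟩ := h1 (Fin.mk_le_mk.2 (Nat.le_succ j))
    rcases hle.lt_or_eq with h3 | h3
    · exact Or.inl h3
    · exact Or.inr ⟨h3, not_lt.1 fun h4 => (h2 j hj ⟨j, hj, rfl, h4⟩).ne h3⟩

/-- A weakly increasing sequence is determined by its content, so at most one sequence can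
contribute to a given coefficient of a fundamental quasisymmetric function. -/
theorem ofFn_eq_blockSeq_iff {α : ℕ →₀ ℕ} {n d : ℕ} (hn : α.support ⊆ range n) {i : Fin d → ℕ}
    (hi : Monotone i) : List.ofFn i = blockSeq α n ↔ ∑ j, Finsupp.single (i j) 1 = α := by
  classical
  have hcount : ∀ x, (blockSeq α n).count x = α x := fun x => by
    rw [count_blockSeq]
    split_ifs with h
    · rfl
    · exact (Finsupp.notMem_support_iff.1 fun h' => h (mem_range.1 (hn h'))).symm
  have hsum : ∀ x, (∑ j, Finsupp.single (i j) 1 : ℕ →₀ ℕ) x = (List.ofFn i).count x := fun x => by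
    rw [← Multiset.coe_count, ← Fin.univ_val_map, Multiset.count_map, Finsupp.finsetSum_apply]
    simp only [Finsupp.single_apply]
    rw [← Finset.card_filter]
    simp only [eq_comm (a := x)]
    rfl
  constructor
  · intro h
    ext x
    rw [hsum, h, hcount]
  · intro h
    refine List.Perm.eq_of_pairwise' (r := (· ≤ ·)) hi.sortedLE_ofFn.pairwise
      (pairwise_blockSeq _ _) (List.perm_iff_count.2 fun x => ?_)
    rw [← hsum, h, hcount]

/-- Both sides are 0 or 1, and both test whether the only candidate, `blockSeq α n`, is compatible
with the descents of `w`. -/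
theorem coeff_fundamental (w : List (Fin N)) (α : ℕ →₀ ℕ) {n : ℕ} (hn : α.support ⊆ range n) :
    MvPowerSeries.coeff α (fundamental w.length (descents w)) =
      wordCoeff w ((List.range n).map fun i => ncComplete N (α i)).prod := by
  classical
  rw [wordCoeff_prod_ncComplete]
  change (Nat.card _ : ℚ) = _
  split_ifs with h
  · obtain ⟨h1, h2⟩ := h
    obtain ⟨i, hi⟩ : ∃ i : Fin w.length → ℕ, List.ofFn i = blockSeq α n :=
      ⟨fun j => (blockSeq α n)[j], List.ext_getElem (by simp [h1]) fun _ _ _ => by simp⟩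
    rw [← hi, pairwise_zip_ofFn_iff] at h2
    rw [Nat.card_eq_one_iff_unique.2, Nat.cast_one]
    refine ⟨⟨fun a b => Subtype.ext (List.ofFn_injective ?_)⟩,
      ⟨⟨i, h2.1, h2.2, (ofFn_eq_blockSeq_iff hn h2.1).1 hi⟩⟩⟩
    rw [(ofFn_eq_blockSeq_iff hn a.2.1).2 a.2.2.2, (ofFn_eq_blockSeq_iff hn b.2.1).2 b.2.2.2]
  · rw [Nat.cast_eq_zero, Nat.card_eq_zero, isEmpty_subtype]
    refine Or.inl ?_
    rintro i ⟨h1, h2, h3⟩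
    have hi := (ofFn_eq_blockSeq_iff hn h1).2 h3
    refine h ⟨?_, ?_⟩
    · rw [← hi, List.length_ofFn]
    · rw [← hi]
      exact (pairwise_zip_ofFn_iff w i).2 ⟨h1, h2⟩

theorem pair_eq_sum (z : NCAlg N) (γ : WordModule N) :
    pair z γ = γ.sum fun w c => (c : ℚ) * wordCoeff w.toList z := rfl

theorem coeff_seriesOf (γ : WordModule N) (α : ℕ →₀ ℕ) :
    MvPowerSeries.coeff α (seriesOf γ) = pair (MvPowerSeries.coeff α (cauchyNC N)) γ := by
  rw [seriesOf, pair_eq_sum, Finsupp.sum, map_sum]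
  refine Finset.sum_congr rfl fun w _ => ?_
  dsimp only
  rw [MvPowerSeries.coeff_smul, coeff_fundamental (n := α.support.sup id + 1) _ _ fun i hi =>
    mem_range.2 (Nat.lt_succ_of_le (Finset.le_sup (f := id) hi))]
  rfl

/-- The pairing with a fixed element of `U^*`. -/
def pairHom (γ : WordModule N) : NCAlg N →ₗ[ℚ] ℚ :=
  γ.sum fun w c => (c : ℚ) • wordCoeff w.toList

theorem pairHom_apply (γ : WordModule N) (z : NCAlg N) : pairHom γ z = pair z γ := by
  rw [pairHom, pair_eq_sum, Finsupp.sum, LinearMap.sum_apply]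
  rfl

theorem boundedDegree_seriesOf (γ : WordModule N) : BoundedDegree (seriesOf γ) := by
  refine ⟨γ.support.sup fun w => w.toList.length, fun α hα => ?_⟩
  rw [seriesOf, Finsupp.sum, map_sum]
  refine Finset.sum_eq_zero fun w hw => ?_
  have hlt : w.toList.length < α.degree :=
    (Finset.le_sup (f := fun w : FreeMonoid (Fin N) => w.toList.length) hw).trans_lt hα
  have h0 : MvPowerSeries.coeff α
      (fundamental w.toList.length (descents w.toList)) = 0 := by
    change (Nat.card _ : ℚ) = 0
    rw [Nat.cast_eq_zero, Nat.card_eq_zero, isEmpty_subtype]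
    refine Or.inl ?_
    rintro i ⟨-, -, h⟩
    rw [← h, map_sum] at hlt
    simp at hlt
  rw [MvPowerSeries.coeff_smul, h0, mul_zero]

end Fundamental

/-! ### Pairing with elements orthogonal to the ideal -/

section Pairing

variable {N : ℕ} {I : TwoSidedIdeal (NCAlg N)}

theorem toQuo_surjective : Function.Surjective (toQuo I) := RingCon.mk'_surjective _

theorem pair_eq_of_toQuo_eq {γ : WordModule N} (hγ : γ ∈ perp I) {a b : NCAlg N}
    (h : toQuo I a = toQuo I b) : pair a γ = pair b γ := by
  rw [← sub_eq_zero, ← pairHom_apply, ← pairHom_apply, ← map_sub, pairHom_apply]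
  exact hγ _ ((toQuo_eq_iff I a b).1 h)

theorem seriesOf_mem_symFun (hI : SatisfiesCommutation I) {γ : WordModule N} (hγ : γ ∈ perp I) :
    seriesOf γ ∈ SymFun := by
  refine (mem_symFun_iff _).2 ⟨boundedDegree_seriesOf γ, fun σ α => ?_⟩
  rw [coeff_seriesOf, coeff_seriesOf]
  refine pair_eq_of_toQuo_eq hγ ?_
  rw [toQuo_coeff_cauchyNC I hI, toQuo_coeff_cauchyNC I hI]
  exact congrArg (fun lam => ncMap I hI (completePart lam)) (par_ext (shape_embDomain _ α))

/-- By linearity only s = h_λ needs checking. There the Hall pairing reads off a coefficient of F_γ,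
which is the pairing of γ with a coefficient of Ω, a representative of φ(h_λ). -/
theorem hall_seriesOf (hI : SatisfiesCommutation I) {γ : WordModule N} (hγ : γ ∈ perp I)
    (hF : seriesOf γ ∈ SymFun) (s : SymFun) (z : NCAlg N) (hz : toQuo I z = ncMap I hI s) :
    hall ⟨seriesOf γ, hF⟩ s = pair z γ := by
  have hs : s ∈ Submodule.span ℚ (Set.range completeBasis) := by
    rw [completeBasis.span_eq]; trivial
  -- The representative must vary: `z` does not come decomposed, so representatives of the summands
  -- are chosen afresh, and orthogonality of γ to `I` absorbs the difference.
  induction hs using Submodule.span_induction generalizing z with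
  | zero =>
    rw [map_zero, pair_eq_of_toQuo_eq hγ (hz.trans ((map_zero _).trans (map_zero (toQuo I)).symm)),
      ← pairHom_apply, map_zero]
  | add x y _ _ hx hy =>
    obtain ⟨a, ha⟩ := toQuo_surjective (ncMap I hI x)
    obtain ⟨b, hb⟩ := toQuo_surjective (ncMap I hI y)
    have hab : toQuo I z = toQuo I (a + b) := by rw [hz, map_add, map_add, ha, hb]
    rw [map_add, hx a ha, hy b hb, pair_eq_of_toQuo_eq hγ hab, ← pairHom_apply, ← pairHom_apply,
      ← pairHom_apply, map_add]
  | smul c x _ hx =>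
    obtain ⟨a, ha⟩ := toQuo_surjective (ncMap I hI x)
    have hab : toQuo I z = toQuo I (c • a) := by rw [hz, map_smul, map_smul, ha]
    rw [map_smul, hx a ha, pair_eq_of_toQuo_eq hγ hab, ← pairHom_apply, ← pairHom_apply, map_smul]
  | mem x hx =>
    obtain ⟨lam, rfl⟩ := hx
    rw [completeBasis_apply] at hz ⊢
    rw [hall_completePart, coeffFun_apply, coeff_seriesOf]
    refine pair_eq_of_toQuo_eq hγ ?_
    rw [toQuo_coeff_cauchyNC I hI, parOf_expo, hz]

end Pairing

/-! ### The noncommutative Cauchy identity -/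

/-- The coefficient of `x^α` in `f_μ^⊥ g_λ` is the coefficient of `f_λ` in `f_μ h_α`. -/
theorem coeff_skew_dual {f g : Module.Basis Par ℚ SymFun}
    (hfg : ∀ lam mu, hall (f lam) (g mu) = if lam = mu then 1 else 0) (a : SymFun) (lam : Par)
    (α : ℕ →₀ ℕ) : MvPowerSeries.coeff α (skew a (g lam) : MvPowerSeries ℕ ℚ) =
      f.repr (a * completePart (parOf α)) lam := by
  -- Coordinates with respect to `f`, not `g`, are needed, so duality is used with the bases
  -- exchanged.
  have hgf : ∀ mu lam, hall (g mu) (f lam) = if mu = lam then 1 else 0 := fun mu lam => by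
    rw [hall_comm, hfg]
    exact if_congr eq_comm rfl rfl
  rw [← coeffFun_apply, ← hall_completePart_parOf, hall_skew, repr_eq_hall hgf]

theorem coeff_C_mul_toNCSeries (N : ℕ) (z : NCAlg N) (s : MvPowerSeries ℕ ℚ) (α : ℕ →₀ ℕ) :
    MvPowerSeries.coeff α (MvPowerSeries.C z * toNCSeries N s) =
      MvPowerSeries.coeff α s • z := by
  rw [MvPowerSeries.coeff_C_mul, MvPowerSeries.coeff_map, ← Algebra.commutes,
    ← Algebra.smul_def]

end NCSkew

end

/-! ### The theorem -/

theorem mainTheorem1 (N : ℕ)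
    (f g : Module.Basis NCSkew.Par ℚ NCSkew.SymFun)
    (hfg : ∀ lam mu, NCSkew.hall (f lam) (g mu) = if lam = mu then 1 else 0)
    (I : TwoSidedIdeal (NCSkew.NCAlg N)) (hI : NCSkew.SatisfiesCommutation I)
    (ff : NCSkew.Par → NCSkew.NCAlg N)
    (hff : ∀ lam, NCSkew.toQuo I (ff lam) = NCSkew.ncMap I hI (f lam)) :
    (∀ mu, ∃ G : MvPowerSeries ℕ (NCSkew.NCAlg N),
      NCSkew.HasFormalSum (fun lam => MvPowerSeries.C (ff lam) *
        NCSkew.toNCSeries N (NCSkew.skew (f mu) (g lam) : MvPowerSeries ℕ ℚ)) G ∧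
      NCSkew.SeriesCongr I (MvPowerSeries.C (ff mu) * NCSkew.cauchyNC N) G) ∧
    ∀ γ ∈ NCSkew.perp I, ∃ hF : NCSkew.seriesOf γ ∈ NCSkew.SymFun, ∀ mu,
      (NCSkew.skew (f mu) ⟨NCSkew.seriesOf γ, hF⟩ : MvPowerSeries ℕ ℚ) =
        NCSkew.pairSeries (MvPowerSeries.C (ff mu) * NCSkew.cauchyNC N) γ ∧
      ∀ lam, g.repr (NCSkew.skew (f mu) ⟨NCSkew.seriesOf γ, hF⟩) lam =
        NCSkew.pair (ff mu * ff lam) γ := by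
  have hrep : ∀ mu (s : NCSkew.SymFun) z, NCSkew.toQuo I z = NCSkew.ncMap I hI s →
      NCSkew.toQuo I (ff mu * z) = NCSkew.ncMap I hI (f mu * s) := fun mu s z hz => by
    rw [map_mul, map_mul, hff, hz]
  constructor
  · intro mu
    -- Only the f_λ occurring in the expansion of f_μ h_α can contribute; this gives finiteness and
    -- turns the `finsum` into the sum over that expansion.
    have hfin : ∀ α : ℕ →₀ ℕ, {lam | MvPowerSeries.coeff α (MvPowerSeries.C (ff lam) *
        NCSkew.toNCSeries N (NCSkew.skew (f mu) (g lam) : MvPowerSeries ℕ ℚ)) ≠ 0} ⊆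
        (f.repr (f mu * NCSkew.completePart (NCSkew.parOf α))).support := by
      intro α lam h
      rw [Finset.mem_coe, Finsupp.mem_support_iff, ← NCSkew.coeff_skew_dual hfg]
      rintro h0
      exact h (by rw [NCSkew.coeff_C_mul_toNCSeries, h0, zero_smul])
    obtain ⟨G, hG⟩ : ∃ G : MvPowerSeries ℕ (NCSkew.NCAlg N), ∀ α, MvPowerSeries.coeff α G =
        ∑ᶠ lam, MvPowerSeries.coeff α (MvPowerSeries.C (ff lam) *
          NCSkew.toNCSeries N (NCSkew.skew (f mu) (g lam) : MvPowerSeries ℕ ℚ)) :=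
      ⟨fun α => ∑ᶠ lam, MvPowerSeries.coeff α (MvPowerSeries.C (ff lam) *
        NCSkew.toNCSeries N (NCSkew.skew (f mu) (g lam) : MvPowerSeries ℕ ℚ)), fun _ => rfl⟩
    refine ⟨G, fun α => ⟨(Finset.finite_toSet _).subset (hfin α), hG α⟩, fun α => ?_⟩
    rw [map_sub, ← NCSkew.toQuo_eq_iff, MvPowerSeries.coeff_C_mul,
      hrep mu _ _ (NCSkew.toQuo_coeff_cauchyNC I hI α), hG]
    rw [finsum_eq_sum_of_support_subset _ (hfin α), map_sum]
    conv_lhs => rw [← f.linearCombination_repr (f mu * _), Finsupp.linearCombination_apply,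
      Finsupp.sum, map_sum]
    refine Finset.sum_congr rfl fun lam _ => ?_
    rw [NCSkew.coeff_C_mul_toNCSeries, NCSkew.coeff_skew_dual hfg, map_smul, map_smul, hff]
  · intro γ hγ
    have hF := NCSkew.seriesOf_mem_symFun hI hγ
    refine ⟨hF, fun mu => ⟨?_, fun lam => ?_⟩⟩
    · ext α
      rw [← NCSkew.coeffFun_apply, ← NCSkew.hall_completePart_parOf, NCSkew.hall_skew]
      change _ = NCSkew.pair (MvPowerSeries.coeff α (MvPowerSeries.C (ff mu) *
        NCSkew.cauchyNC N)) γ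
      rw [MvPowerSeries.coeff_C_mul]
      exact NCSkew.hall_seriesOf hI hγ hF _ _
        (hrep mu _ _ (NCSkew.toQuo_coeff_cauchyNC I hI α))
    -- The coordinate at g_λ is ⟨f_λ, f_μ^⊥ F_γ⟩ = ⟨F_γ, f_μ f_λ⟩; symmetry brings the skewed
    -- function into the first argument, where adjointness applies.
    · rw [NCSkew.repr_eq_hall hfg, NCSkew.hall_comm, NCSkew.hall_skew]
      exact NCSkew.hall_seriesOf hI hγ hF _ _ (hrep mu _ _ (hff lam))
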